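/- Let $\Omega\subset\mathbb R^2$ be a Jordan domain (a bounded domain whose boundary is a Jordan curve). For $\epsilon\ge 0$ put $\gamma_\epsilon=\{x\in\overline\Omega:\operatorname{dist}(x,\partial\Omega)=\epsilon\}$, so $\gamma_0=\partial\Omega$. A rectifiable Jordan curve $\gamma$ is a $c$-chord-arc curve if for all $x,y\in\gamma$ the shorter of the two arcs of $\gamma$ between $x$ and $y$ has length at most $c|x-y|$. The domain $\Omega$ has the level chord-arc property with data $(\epsilon_0,c_0)$, where $\epsilon_0>0$ and $c_0\ge 1$, if $\gamma_\epsilon$ is a $c_0$-chord-arc curve for every $0\le\epsilon\le\epsilon_0$; it has the level chord-arc property if this holds for some such data. Let $\mathcal F$ be the class of homeomorphisms $\varphi:[0,\infty)\to[0,\infty)$ with $\varphi(0)=0$ and $\liminf_{t\to0}\varphi(t)/t>0$ that are Lipschitz on $[r,\infty)$ for every $r>0$, and let $$\Sigma(\Omega,\varphi)=\{(x,z)\in\mathbb R^2\times\mathbb R: x\in\overline\Omega,\ z=\pm\varphi(\operatorname{dist}(x,\partial\Omega))\}\subset\mathbb R^3$$ with the Euclidean metric; let $B(a,r)$ denote its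 open balls. A metric space $X$ is Ahlfors $2$-regular with constant $C>1$ if $C^{-1}r^2\le\mathcal H^2(B(a,r))\le Cr^2$ for all $a\in X$ and all $0<r\le\operatorname{diam}X$, and Ahlfors $2$-regular if this holds for some $C>1$. (1) If $\Omega$ has the level chord-arc property, then $\Sigma(\Omega,\varphi)$ is Ahlfors $2$-regular for every $\varphi\in\mathcal F$. (2) Quantitatively, suppose that $\Omega$ has the level chord-arc property with data $(\epsilon_0,c_0)$ and that $\varphi\in\mathcal F$ is $L$-Lipschitz on $[\epsilon_0/3,\infty)$. (2a) There is a constant $C>1$ depending only on $c_0$, $\epsilon_0$, $L$ and $\operatorname{diam}\Omega$ such that, for every $a\in\Sigma(\Omega,\varphi)$, one has $\mathcal H^2(B(a,r))\le Cr^2$ for all $r>0$ and $\mathcal H^2(B(a,r))\ge C^{-1}r^2$ for all $0<r\le\operatorname{diam}\Omega$. (2b) $\Sigma(\Omega,\varphi)$ is Ahlfors $2$-regular (for all $0<r\le\operatorname{diam}\Sigma(\Omega,\varphi)$) with a constant $C>1$ depending only on $c_0$, $\epsilon_0$, $L$, $\operatorname{diam}\Omega$ and an upper bound for $\varphi(\epsilon_0/3)$.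 -/

import Mathlib

open Set Filter Topology MeasureTheory
open scoped NNReal ENNReal

namespace DoubleDome

/-- The Euclidean plane. -/
abbrev Plane : Type := EuclideanSpace ℝ (Fin 2)

/-- Euclidean three-space. -/
abbrev Space : Type := EuclideanSpace ℝ (Fin 3)

/-- `g` restricted to `[0,1]` is a closed simple parametrization of the set `S`. -/
structure IsJordanParam (g : ℝ → Plane) (S : Set Plane) : Prop where
  continuousOn : ContinuousOn g (Icc 0 1)
  closed : g 0 = g 1
  injOn : InjOn g (Ico 0 1)
  image_eq : g '' Icc 0 1 = S

/-- A Jordan curve: a homeomorphic image of the circle in the plane. -/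
def IsJordanCurve (S : Set Plane) : Prop :=
  ∃ g : ℝ → Plane, IsJordanParam g S

/-- A planar Jordan domain: a bounded domain whose boundary is a Jordan curve. -/
structure IsJordanDomain (Ω : Set Plane) : Prop where
  isOpen : IsOpen Ω
  isConnected : IsConnected Ω
  isBounded : Bornology.IsBounded Ω
  frontier : IsJordanCurve (frontier Ω)

/-- A `c`-chord-arc curve: a rectifiable Jordan curve such that, for any two of its points, the
shorter of the two arcs between them has length at most `c` times their distance. In a closed
simple parametrization by `[0,1]` the two arcs between `g s` and `g t`, `s ≤ t`, are
`g '' [s,t]` and `g '' [0,s] ∪ g '' [t,1]`. -/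
def IsChordArcCurve (c : ℝ) (S : Set Plane) : Prop :=
  ∃ g : ℝ → Plane, IsJordanParam g S ∧ eVariationOn g (Icc 0 1) ≠ ∞ ∧
    ∀ s t : ℝ, 0 ≤ s → s ≤ t → t ≤ 1 →
      min (eVariationOn g (Icc s t)) (eVariationOn g (Icc 0 s) + eVariationOn g (Icc t 1))
        ≤ ENNReal.ofReal (c * dist (g s) (g t))

/-- Distance to the boundary of `Ω`. -/
noncomputable def bdist (Ω : Set Plane) (x : Plane) : ℝ≥0 :=
  Metric.infNndist x (frontier Ω)

/-- The `ε`-level set of the distance to the boundary. It is taken in the closure of `Ω`, so that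
the level `0` is the boundary of `Ω`; for `ε > 0` this makes no difference. -/
def levelSet (Ω : Set Plane) (ε : ℝ≥0) : Set Plane :=
  {x | x ∈ closure Ω ∧ bdist Ω x = ε}

/-- All level sets with `0 ≤ ε ≤ ε₀` are `c`-chord-arc curves. -/
def HasLevelChordArcWith (Ω : Set Plane) (ε₀ : ℝ≥0) (c : ℝ) : Prop :=
  ∀ ε : ℝ≥0, ε ≤ ε₀ → IsChordArcCurve c (levelSet Ω ε)

/-- The level chord-arc property. -/
def HasLevelChordArc (Ω : Set Plane) : Prop :=
  ∃ ε₀ : ℝ≥0, 0 < ε₀ ∧ ∃ c : ℝ, 1 ≤ c ∧ HasLevelChordArcWith Ω ε₀ c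

/-- The class of gauges: self-homeomorphisms of `[0,∞)` fixing `0` with
`liminf_{t → 0} φ t / t > 0` (the value `∞` is allowed) that are Lipschitz away from `0`. -/
structure IsGauge (φ : ℝ≥0 → ℝ≥0) : Prop where
  isHomeomorph : IsHomeomorph φ
  map_zero : φ 0 = 0
  liminf_pos : 0 < liminf (fun t : ℝ≥0 => (φ t : ℝ≥0∞) / (t : ℝ≥0∞)) (𝓝[>] 0)
  lipschitz : ∀ r : ℝ≥0, 0 < r → ∃ L : ℝ≥0, LipschitzOnWith L φ (Ici r)

/-- The orthogonal projection of space onto the horizontal plane. -/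
def proj (p : Space) : Plane := !₂[p 0, p 1]

/-- The double-dome-like surface over `Ω` with gauge `φ`. -/
def surface (Ω : Set Plane) (φ : ℝ≥0 → ℝ≥0) : Set Space :=
  {p | proj p ∈ closure Ω ∧
    (p 2 = (φ (bdist Ω (proj p)) : ℝ) ∨ p 2 = -(φ (bdist Ω (proj p)) : ℝ))}

/-- Ahlfors `Q`-regularity of a metric space with constant `C`. -/
def IsAhlforsRegularWith (X : Type*) [MetricSpace X] [MeasurableSpace X] [BorelSpace X]
    (Q C : ℝ) : Prop :=
  ∀ (a : X) (r : ℝ), 0 < r → ENNReal.ofReal r ≤ Metric.ediam (univ : Set X) →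
    ENNReal.ofReal (C⁻¹ * r ^ Q) ≤ Measure.hausdorffMeasure Q (Metric.ball a r) ∧
      Measure.hausdorffMeasure Q (Metric.ball a r) ≤ ENNReal.ofReal (C * r ^ Q)

/-- Ahlfors `Q`-regularity of a metric space. -/
def IsAhlforsRegular (X : Type*) [MetricSpace X] [MeasurableSpace X] [BorelSpace X]
    (Q : ℝ) : Prop :=
  ∃ C : ℝ, 1 < C ∧ IsAhlforsRegularWith X Q C

end DoubleDome

namespace DoubleDome

/-! ### Continuous logarithms and separation in the complex plane -/

/-! The surface is sliced by the height `t + φ t`, where `t` is the distance of the base point to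
the boundary. On the surface the height is 2-Lipschitz, and on either sheet its fibres are copies of
the level curves. Both horizontal and vertical displacements between levels are bounded by the
difference of heights, so the estimates do not depend on the behaviour of `φ` near 0.

Upper bound: where `t ≥ ε₀ / 3` the surface lies in two Lipschitz graphs. Where `t ≤ ε₀`, separated
points in a thin slab of heights are pushed to a single level curve and stay separated. The
chord-arc condition allows `O(r / δ)` of them, and `O(r / δ)` slabs meet the ball
(`card_mul_sq_le_of_bdist_le`). Such a quadratic packing bound controls the measure
(`hausdorffMeasure_two_le_of_packing`).

Lower bound: far from the boundary the projection of a small ball of the surface contains a disc.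
Near it, a coarea-type inequality (`mul_le_hausdorffMeasure_two_of_slices`) needs an interval of
heights, of length comparable to the radius, whose fibres in the ball contain connected sets of
comparable diameter. If the height of the centre is not small, the levels just below it serve.
Otherwise one needs a nearby point of the domain whose distance to the boundary is comparable to the
radius. It exists because the boundary has bounded turning (`exists_mem_sphere_le_infDist`):
otherwise the boundary together with an arc system close to it would separate two points that the
boundary does not, which continuous logarithms of `(z - q) / (z - q')` rule out. -/

theorem eq_of_continuousOn_of_exp_eq_one {X : Type*} [TopologicalSpace X] {J : Set X}
    (hJ : IsPreconnected J) {D : X → ℂ} (hD : ContinuousOn D J)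
    (h1 : ∀ x ∈ J, Complex.exp (D x) = 1) {x y : X} (hx : x ∈ J) (hy : y ∈ J) : D x = D y := by
  refine hJ.induction₂ (fun x y => D x = D y) (fun x hx => ?_)
    (fun x y z _ _ _ h h' => h.trans h') (fun x y _ _ h => h.symm) hx hy
  have h2 : ∀ᶠ y in 𝓝[J] x, dist (D y) (D x) < 1 :=
    (hD x hx).eventually (Metric.ball_mem_nhds _ one_pos)
  filter_upwards [h2, self_mem_nhdsWithin] with y hy hyJ
  have h3 : Complex.exp (D y - D x) = 1 := by
    rw [Complex.exp_sub, h1 x hx, h1 y hyJ, div_one]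
  obtain ⟨n, hn⟩ := Complex.exp_eq_one_iff.1 h3
  rw [dist_eq_norm, hn] at hy
  have h4 : ‖(n : ℂ) * (2 * (Real.pi : ℂ) * Complex.I)‖ = |(n : ℝ)| * (2 * Real.pi) := by
    simp [abs_of_pos Real.pi_pos]
  rw [h4] at hy
  have h5 : |(n : ℝ)| < 1 := by
    have := Real.pi_gt_three
    nlinarith [abs_nonneg (n : ℝ)]
  have h6 : n = 0 := by
    rw [← Int.cast_abs] at h5
    have : |n| < 1 := by exact_mod_cast h5
    exact Int.abs_lt_one_iff.1 this
  rw [h6] at hn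
  simp only [Int.cast_zero, zero_mul, sub_eq_zero] at hn
  exact hn.symm

theorem exists_continuous_log {k : ℂ → ℂ} (hk : Continuous k) (h0 : ∀ z, k z ≠ 0) :
    ∃ l : ℂ → ℂ, Continuous l ∧ ∀ z, Complex.exp (l z) = k z := by
  obtain ⟨l, ⟨-, hl⟩, -⟩ := Complex.isCoveringMapOn_exp.existsUnique_continuousMap_lifts
    ⟨k, hk⟩ (a₀ := 0) (Complex.exp_log (h0 0)) (fun z => h0 z)
  exact ⟨l, l.continuous, fun z => congr($hl z)⟩

/-- A logarithm of `z - q` gains `2πi` after one turn, which continuity on the circle forbids. -/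
theorem not_exists_log_on_circle {q : ℂ} {R : ℝ} (hR : 0 < R) {l : ℂ → ℂ} (hl : Continuous l)
    (he : ∀ z, dist z q = R → Complex.exp (l z) = z - q) : False := by
  let z : ℝ → ℂ := fun θ => q + R * Complex.exp (θ * Complex.I)
  have hz : Continuous z := by fun_prop
  let D : ℝ → ℂ := fun θ => l (z θ) - (Real.log R + θ * Complex.I)
  have hD : Continuous D := by fun_prop
  have h1 : ∀ θ ∈ (univ : Set ℝ), Complex.exp (D θ) = 1 := by
    intro θ _
    have h2 : dist (z θ) q = R := by
      simp only [z, dist_eq_norm, add_sub_cancel_left, norm_mul, Complex.norm_real,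
        Complex.norm_exp_ofReal_mul_I, mul_one, Real.norm_eq_abs, abs_of_pos hR]
    have h3 : Complex.exp (Real.log R) = R := by
      rw [← Complex.ofReal_exp, Real.exp_log hR]
    simp only [D]
    rw [Complex.exp_sub, Complex.exp_add, he _ h2, h3]
    simp only [z, add_sub_cancel_left]
    exact div_self (mul_ne_zero (by exact_mod_cast hR.ne') (Complex.exp_ne_zero _))
  have h4 := eq_of_continuousOn_of_exp_eq_one isPreconnected_univ hD.continuousOn h1
    (mem_univ 0) (mem_univ (2 * Real.pi))
  have h5 : z (2 * Real.pi) = z 0 := by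
    simp only [z]
    push_cast
    rw [Complex.exp_two_pi_mul_I]
    simp
  simp only [D, h5] at h4
  have h6 := congrArg Complex.im h4
  simp at h6
  linarith [Real.pi_pos]

/-- If a closed set contains the frontier of a bounded open set `U`, then `(z - q) / (z - q')`
has no continuous logarithm on it when `q` is inside `U` and `q'` is outside. -/
theorem not_exists_log_of_separates {U K : Set ℂ} (hb : Bornology.IsBounded U)
    {q q' : ℂ} (hq : q ∈ U) (hq' : q' ∉ U) (hK : IsClosed K) (hfr : frontier U ⊆ K)
    (hq'K : q' ∉ K) {g : ℂ → ℂ} (hg : ContinuousOn g K)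
    (he : ∀ z ∈ K, Complex.exp (g z) = (z - q) / (z - q')) : False := by
  classical
  obtain ⟨G, hG⟩ := ContinuousMap.exists_restrict_eq hK ⟨K.domRestrict g, hg.domRestrict⟩
  have hGK : ∀ z ∈ K, G z = g z := fun z hz => congr($hG ⟨z, hz⟩)
  -- With `G` the Tietze extension of `g`, the two formulas agree on the frontier of `U`, so `k` is
  -- continuous and zero-free on the plane and has a logarithm. On a large circle about `q`, outside
  -- `U`, this is a logarithm of `z - q`.
  let k : ℂ → ℂ := U.piecewise (fun z => (z - q') * Complex.exp (G z)) (fun z => z - q)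
  have hk : Continuous k := by
    refine Continuous.piecewise (fun z hz => ?_) (by fun_prop) (by fun_prop)
    have hzK := hfr hz
    rw [hGK z hzK, he z hzK, mul_div_cancel₀]
    exact fun h => hq'K (by rwa [← sub_eq_zero.1 h])
  have hk0 : ∀ z, k z ≠ 0 := by
    intro z
    by_cases hz : z ∈ U
    · simp only [k, piecewise_eq_of_mem _ _ _ hz]
      exact mul_ne_zero (fun h => hq' (by rwa [← sub_eq_zero.1 h])) (Complex.exp_ne_zero _)
    · simp only [k, piecewise_eq_of_notMem _ _ _ hz]
      exact fun h => hz (by rwa [sub_eq_zero.1 h])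
  obtain ⟨l, hl, hle⟩ := exists_continuous_log hk hk0
  obtain ⟨R, hR0, hR⟩ := hb.subset_ball_lt 0 q
  refine not_exists_log_on_circle hR0 hl (q := q) (fun z hz => ?_)
  rw [hle]
  refine piecewise_eq_of_notMem _ _ _ (fun h => ?_)
  have := hR h
  rw [Metric.mem_ball, hz] at this
  exact lt_irrefl _ this

/-- Points in the same preconnected open set off a set are not separated by it. -/
theorem exists_log_of_isPreconnected {Ω Γ : Set ℂ} (hΩ : IsOpen Ω) (hc : IsPreconnected Ω)
    (hd : Disjoint Ω Γ) {q q' : ℂ} (hq : q ∈ Ω) (hq' : q' ∈ Ω) :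
    ∃ g : ℂ → ℂ, ContinuousOn g Γ ∧ ∀ z ∈ Γ, Complex.exp (g z) = (z - q) / (z - q') := by
  have hne : ∀ x ∈ Ω, ∀ z ∈ Γ, z - x ≠ 0 := fun x hx z hz h =>
    disjoint_left.1 hd hx (by rwa [← sub_eq_zero.1 h])
  -- Admitting a logarithm of the quotient is an equivalence relation between points of `Ω`, so only
  -- nearby pairs matter. For those the quotient stays in the right half-plane and the principal
  -- branch works.
  refine hc.induction₂ (fun q q' => ∃ g : ℂ → ℂ, ContinuousOn g Γ ∧
    ∀ z ∈ Γ, Complex.exp (g z) = (z - q) / (z - q')) (fun x hx => ?_) ?_ ?_ hq hq'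
  · obtain ⟨r, hr, hrΩ⟩ := Metric.isOpen_iff.1 hΩ x hx
    have : ∀ᶠ y in 𝓝[Ω] x, dist y x < r / 2 :=
      mem_nhdsWithin_of_mem_nhds (Metric.ball_mem_nhds _ (by positivity))
    filter_upwards [this, self_mem_nhdsWithin] with y hy hyΩ
    have hs : ∀ z ∈ Γ, (z - x) / (z - y) ∈ Complex.slitPlane := by
      intro z hz
      have h1 : r ≤ dist z x := by
        by_contra! h
        exact disjoint_left.1 hd (hrΩ h) hz
      have h2 : r / 2 < ‖z - y‖ := by
        rw [← dist_eq_norm]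
        linarith [dist_triangle z y x]
      have h3 : ‖(z - x) / (z - y) - 1‖ < 1 := by
        rw [div_sub_one (hne y hyΩ z hz), norm_div, div_lt_one (by linarith)]
        rw [dist_eq_norm] at hy
        calc ‖z - x - (z - y)‖ = ‖y - x‖ := by congr 1; ring
          _ < ‖z - y‖ := by linarith
      have h4 := (abs_le.1 (Complex.abs_re_le_norm ((z - x) / (z - y) - 1))).1
      left
      simp only [Complex.sub_re, Complex.one_re] at h4
      linarith
    refine ⟨fun z => Complex.log ((z - x) / (z - y)), ?_, fun z hz => ?_⟩
    · refine ContinuousOn.clog (ContinuousOn.div (by fun_prop) (by fun_prop)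
        (fun z hz => hne y hyΩ z hz)) hs
    · exact Complex.exp_log (div_ne_zero (hne x hx z hz) (hne y hyΩ z hz))
  · rintro x y z hx hy hz ⟨g, hg, hge⟩ ⟨g', hg', hge'⟩
    refine ⟨fun w => g w + g' w, hg.add hg', fun w hw => ?_⟩
    rw [Complex.exp_add, hge w hw, hge' w hw]
    exact div_mul_div_cancel₀ (hne y hy w hw)
  · rintro x y hx hy ⟨g, hg, hge⟩
    refine ⟨fun w => - g w, hg.neg, fun w hw => ?_⟩
    rw [Complex.exp_neg, hge w hw, inv_div]

/-- The double quotient is `(1 + x) * (1 + y)` with `‖x‖, ‖y‖ ≤ 1 / 4`, hence within `9 / 16` of 1.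
-/
theorem re_div_pos_of_norm_sub_le {a b q q' : ℂ} (hbq : b ≠ q) (haq' : a ≠ q')
    (h : ‖a - b‖ ≤ ‖b - q‖ / 4) (h' : ‖a - b‖ ≤ ‖a - q'‖ / 4) :
    0 < (((a - q) / (a - q')) / ((b - q) / (b - q'))).re := by
  have hb : b - q ≠ 0 := sub_ne_zero.2 hbq
  have ha : a - q' ≠ 0 := sub_ne_zero.2 haq'
  set x := (a - b) / (b - q) with hx
  set y := (b - a) / (a - q') with hy
  have h1 : ((a - q) / (a - q')) / ((b - q) / (b - q')) = 1 + (x + y + x * y) := by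
    rw [hx, hy]
    field_simp
    ring
  have hxn : ‖x‖ ≤ 1 / 4 := by
    rw [hx, norm_div, div_le_iff₀ (norm_pos_iff.2 hb)]
    linarith
  have hyn : ‖y‖ ≤ 1 / 4 := by
    rw [hy, norm_div, div_le_iff₀ (norm_pos_iff.2 ha), norm_sub_rev]
    linarith
  have h2 : ‖x + y + x * y‖ ≤ 9 / 16 := by
    have h3 : ‖x * y‖ ≤ 1 / 4 * (1 / 4) := by
      rw [norm_mul]
      exact mul_le_mul hxn hyn (norm_nonneg _) (by norm_num)
    have := norm_add₃_le (a := x) (b := y) (c := x * y)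
    linarith
  rw [h1, Complex.add_re, Complex.one_re]
  linarith [(abs_le.1 (Complex.abs_re_le_norm (x + y + x * y))).1]

/-- Two arguments in `(-π/2, π/2)` add up without leaving the principal branch. -/
theorem log_div_eq_add_of_re_pos {x y z : ℂ} (hxy : 0 < (x / y).re) (hyz : 0 < (y / z).re) :
    Complex.log (x / z) = Complex.log (x / y) + Complex.log (y / z) := by
  have h1 : x / y ≠ 0 := fun h => by simp [h] at hxy
  have h2 : y / z ≠ 0 := fun h => by simp [h] at hyz
  have hy : y ≠ 0 := fun h => by simp [h] at h1
  have a1 := abs_lt.1 (Complex.abs_arg_lt_pi_div_two_iff.2 (Or.inl hxy))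
  have a2 := abs_lt.1 (Complex.abs_arg_lt_pi_div_two_iff.2 (Or.inl hyz))
  rw [← Complex.log_mul h1 h2 ⟨by linarith, by linarith⟩, div_mul_div_cancel₀ hy]

/-- A domain with a frontier of bounded turning contains, on each circle about a frontier point
which it crosses, a point whose distance from the frontier is comparable to the radius. -/
theorem exists_mem_sphere_le_infDist {Ω : Set ℂ} (hΩ : IsOpen Ω) (hpc : IsPreconnected Ω)
    (hb : Bornology.IsBounded Ω) {c : ℝ} (hc : 1 ≤ c)
    (hturn : ∀ u ∈ frontier Ω, ∀ v ∈ frontier Ω, ∃ J ⊆ frontier Ω, IsPreconnected J ∧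
      u ∈ J ∧ v ∈ J ∧ ∀ x ∈ J, dist x u ≤ c * dist u v)
    (hne : (frontier Ω).Nonempty) {p q q' : ℂ} {ρ : ℝ} (hρ : 0 < ρ) (hq : q ∈ Ω) (hq' : q' ∈ Ω)
    (hqp : dist q p ≤ ρ / 2) (hq'p : 2 * ρ ≤ dist q' p) :
    ∃ w ∈ closure Ω, dist w p = ρ ∧ ρ / (100 * c) ≤ Metric.infDist w (frontier Ω) := by
  classical
  by_contra! hcon
  set Γ := frontier Ω with hΓdef
  set S' := Metric.sphere p ρ ∩ closure Ω with hS'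
  -- All comparisons below take place within `4 * c * δ = ρ / 25` of the circle, where the distances
  -- to `q` and `q'` are comparable to `ρ`.
  set δ := ρ / (100 * c) with hδdef
  have hcpos : 0 < c := by linarith
  have hδ : 0 < δ := by positivity
  have hcδ : c * δ = ρ / 100 := by rw [hδdef]; field_simp
  have hδc : δ ≤ c * δ := le_mul_of_one_le_left hδ.le hc
  have hΓcl : IsClosed Γ := isClosed_frontier
  have hdisj : Disjoint Ω Γ := (disjoint_frontier_iff_isOpen.2 hΩ).symm
  have hΓcomp : IsCompact Γ :=
    Metric.isCompact_of_isClosed_isBounded hΓcl (hb.closure.subset frontier_subset_closure)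
  obtain ⟨g, hg, hge⟩ := exists_log_of_isPreconnected hΩ hpc hdisj hq hq'
  set f : ℂ → ℂ := fun z => (z - q) / (z - q') with hf
  -- A point of `Γ` near `w`, chosen to be `w` itself on `Γ` so that the extension below agrees with
  -- `g` there.
  have hnear : ∀ w, ∃ v, w ∈ S' → v ∈ Γ ∧ dist w v < δ ∧ (w ∈ Γ → v = w) := by
    intro w
    by_cases hw : w ∈ S'
    · by_cases hwΓ : w ∈ Γ
      · exact ⟨w, fun _ => ⟨hwΓ, by simpa using hδ, fun _ => rfl⟩⟩
      · obtain ⟨v, hv, hvd⟩ := hΓcomp.exists_infDist_eq_dist hne w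
        exact ⟨v, fun _ => ⟨hv, hvd ▸ hcon w hw.2 hw.1, fun h => absurd h hwΓ⟩⟩
    · exact ⟨w, fun h => absurd h hw⟩
  choose π hπ using hnear
  have hratio : ∀ a b w, dist w p = ρ → dist a w ≤ 4 * (c * δ) → dist b w ≤ 4 * (c * δ) →
      0 < (f a / f b).re := by
    intro a b w hw ha hb
    have hab : dist a b ≤ 8 * (c * δ) := by linarith [dist_triangle_right a b w]
    have hbq : 23 / 50 * ρ ≤ dist b q := by
      linarith [dist_triangle4 w b q p, dist_comm w b]
    have haq : 24 / 25 * ρ ≤ dist a q' := by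
      linarith [dist_triangle4 q' a w p, dist_comm a q']
    refine re_div_pos_of_norm_sub_le (dist_pos.1 (by linarith)) (dist_pos.1 (by linarith)) ?_ ?_
    · rw [← dist_eq_norm, ← dist_eq_norm]; linarith
    · rw [← dist_eq_norm, ← dist_eq_norm]; linarith
  -- The logarithm is carried from `π w` to `w` by the principal branch. Although `π` need not be
  -- continuous, `G` is.
  set G : ℂ → ℂ := fun w => g (π w) - Complex.log (f (π w) / f w) with hG
  have hf0 : ∀ w ∈ S', f w ≠ 0 := fun w hw h => by
    have := hratio w w w hw.1 (by simp; positivity) (by simp; positivity)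
    simp [h] at this
  have hkey : ∀ w ∈ S', ∀ w₀ ∈ S', dist w w₀ < δ →
      G w = G w₀ + Complex.log (f w / f w₀) := by
    intro w hw w₀ hw₀ hd
    obtain ⟨hπw, hdw, -⟩ := hπ w hw
    obtain ⟨hπw₀, hdw₀, -⟩ := hπ w₀ hw₀
    obtain ⟨J, hJΓ, hJ, hJ1, hJ2, hJd⟩ := hturn _ hπw₀ _ hπw
    have hππ : dist (π w₀) (π w) ≤ 3 * δ := by
      linarith [dist_triangle4 (π w₀) w₀ w (π w), dist_comm (π w₀) w₀, dist_comm w₀ w]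
    have hJw₀ : ∀ x ∈ J, dist x w₀ ≤ 4 * (c * δ) := fun x hx => by
      have h1 : c * dist (π w₀) (π w) ≤ c * (3 * δ) := mul_le_mul_of_nonneg_left hππ hcpos.le
      linarith [dist_triangle x (π w₀) w₀, hJd x hx, dist_comm (π w₀) w₀]
    have hw₀w₀ : dist w₀ w₀ ≤ 4 * (c * δ) := by simp; positivity
    have hre : ∀ x ∈ J, 0 < (f x / f w₀).re := fun x hx =>
      hratio x w₀ w₀ hw₀.1 (hJw₀ x hx) hw₀w₀
    have hfJ : ContinuousOn (fun x => f x / f w₀) J := by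
      refine ContinuousOn.div_const (ContinuousOn.div (by fun_prop) (by fun_prop) ?_) _
      exact fun x hx h => disjoint_left.1 hdisj hq' (by
        rw [← sub_eq_zero.1 h]; exact hJΓ hx)
    -- Bounded turning joins `π w₀` to `π w` by a connected `J` in `Γ` near `w₀`. Along `J` the
    -- function `g` differs from the principal branch by a constant, so the choice of `π` does not
    -- matter.
    have hE := eq_of_continuousOn_of_exp_eq_one hJ
      (D := fun x => g x - Complex.log (f x / f w₀) - Complex.log (f w₀))
      (((hg.mono hJΓ).sub (hfJ.clog (fun x hx => Or.inl (hre x hx)))).sub continuousOn_const)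
      (fun x hx => by
        have hx0 : f x / f w₀ ≠ 0 := fun h => by
          have := hre x hx
          simp [h] at this
        have hfx : f x ≠ 0 := fun h => by simp [h] at hx0
        rw [Complex.exp_sub, Complex.exp_sub, Complex.exp_log hx0, Complex.exp_log (hf0 _ hw₀),
          hge x (hJΓ hx)]
        change f x / (f x / f w₀) / f w₀ = 1
        have := hf0 _ hw₀
        field_simp) hJ1 hJ2
    have hlog := log_div_eq_add_of_re_pos (x := f (π w)) (y := f w) (z := f w₀)
      (hratio (π w) w w hw.1 (by rw [dist_comm]; linarith) (by simp; positivity))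
      (hratio w w₀ w₀ hw₀.1 (by linarith) hw₀w₀)
    simp only [hG]
    linear_combination hlog - hE
  have hGc : ContinuousOn G S' := by
    intro w₀ hw₀
    have h1 : (fun w => G w₀ + Complex.log (f w / f w₀)) =ᶠ[𝓝[S'] w₀] G := by
      have : ∀ᶠ w in 𝓝[S'] w₀, dist w w₀ < δ :=
        mem_nhdsWithin_of_mem_nhds (Metric.ball_mem_nhds _ hδ)
      filter_upwards [this, self_mem_nhdsWithin] with w hw hwS
      exact (hkey w hwS w₀ hw₀ hw).symm
    refine ContinuousWithinAt.congr_of_eventuallyEq ?_ h1.symm ?_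
    · refine continuousWithinAt_const.add (ContinuousWithinAt.clog
        (ContinuousWithinAt.div_const (ContinuousWithinAt.div (by fun_prop) (by fun_prop) ?_) _) ?_)
      · intro h
        refine hf0 _ hw₀ ?_
        simp only [hf, h, div_zero]
      · simp [div_self (hf0 _ hw₀)]
    · simp [div_self (hf0 _ hw₀)]
  have hGg : ∀ w ∈ S', w ∈ Γ → G w = g w := fun w hw hwΓ => by
    simp only [hG]
    rw [(hπ w hw).2.2 hwΓ, div_self (hf0 w hw), Complex.log_one, sub_zero]
  have hS'cl : IsClosed S' := Metric.isClosed_sphere.inter isClosed_closure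
  have hqρ : q ∈ Ω ∩ Metric.ball p ρ := ⟨hq, by rw [Metric.mem_ball]; linarith⟩
  -- `Γ ∪ S'` contains the frontier of `Ω ∩ ball p ρ`, which holds `q` but not `q'`, so the glued
  -- logarithm is impossible.
  refine not_exists_log_of_separates (U := Ω ∩ Metric.ball p ρ) (K := Γ ∪ S')
    (hb.subset inter_subset_left) hqρ (q' := q') ?_ (hΓcl.union hS'cl) ?_ ?_
    (g := fun w => if w ∈ Γ then g w else G w) ?_ ?_
  · rintro ⟨-, h⟩
    rw [Metric.mem_ball] at h
    linarith
  · refine (frontier_inter_subset _ _).trans (union_subset_union inter_subset_left ?_)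
    rintro z ⟨hz1, hz2⟩
    exact ⟨Metric.frontier_ball_subset_sphere hz2, hz1⟩
  · rintro (h | h)
    · exact disjoint_left.1 hdisj hq' h
    · have : dist q' p = ρ := h.1
      linarith
  · refine ContinuousOn.union_of_isClosed (hg.congr fun w hw => if_pos hw)
      (hGc.congr fun w hw => ?_) hΓcl hS'cl
    by_cases hwΓ : w ∈ Γ
    · simp only [if_pos hwΓ, hGg w hw hwΓ]
    · simp only [if_neg hwΓ]
  · intro z hz
    by_cases hzΓ : z ∈ Γ
    · simp only [if_pos hzΓ]
      exact hge z hzΓ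
    · simp only [if_neg hzΓ]
      have hzS := hz.resolve_left hzΓ
      obtain ⟨h1, h2, -⟩ := hπ z hzS
      have h3 := hratio (π z) z z hzS.1 (by rw [dist_comm]; linarith) (by simp; positivity)
      have h4 : f (π z) / f z ≠ 0 := fun h => by simp [h] at h3
      have h5 : f (π z) ≠ 0 := fun h => by simp [h] at h4
      simp only [hG]
      rw [Complex.exp_sub, hge _ h1, Complex.exp_log h4]
      change f (π z) / (f (π z) / f z) = f z
      have := hf0 _ hzS
      field_simp

/-! ### Estimates of the two-dimensional Hausdorff measure -/

section HausdorffMeasure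

open Metric Measure

variable {X : Type*} [MetricSpace X]

/-- The distance from `x` is 1-Lipschitz and maps `E` onto a set containing `[0, dist x y]`, whose
length the images of the pieces must cover. -/
theorem le_tsum_ediam_of_isPreconnected {E : Set X} (hE : IsPreconnected E) {x y : X}
    (hx : x ∈ E) (hy : y ∈ E) {t : ℕ → Set X} (ht : E ⊆ ⋃ n, t n) :
    edist x y ≤ ∑' n, ediam (t n ∩ E) := by
  let h : X → ℝ := fun z => dist x z
  have hh : LipschitzWith 1 h := LipschitzWith.dist_right x
  have h1 : Icc 0 (dist x y) ⊆ h '' E := by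
    have := hE.intermediate_value hx hy hh.continuous.continuousOn
    simpa [h] using this
  have h2 : Icc 0 (dist x y) ⊆ ⋃ n, h '' (t n ∩ E) := by
    refine h1.trans ?_
    rintro _ ⟨z, hz, rfl⟩
    obtain ⟨n, hn⟩ := mem_iUnion.1 (ht hz)
    exact mem_iUnion.2 ⟨n, z, ⟨hn, hz⟩, rfl⟩
  calc edist x y = volume (Icc 0 (dist x y)) := by rw [Real.volume_Icc, sub_zero, edist_dist]
    _ ≤ volume (⋃ n, h '' (t n ∩ E)) := measure_mono h2
    _ ≤ ∑' n, volume (h '' (t n ∩ E)) := measure_iUnion_le _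
    _ ≤ ∑' n, ediam (t n ∩ E) := by
        refine ENNReal.tsum_le_tsum fun n => (Real.volume_le_diam _).trans ?_
        simpa using hh.ediam_image_le (t n ∩ E)

theorem exists_maximal_separated {A : Set X} {δ : ℝ} (hδ : 0 < δ) {N : ℕ}
    (h : ∀ P : Finset X, ↑P ⊆ A → (↑P : Set X).Pairwise (fun x y => δ ≤ dist x y) →
      P.card ≤ N) :
    ∃ P : Finset X, ↑P ⊆ A ∧ (↑P : Set X).Pairwise (fun x y => δ ≤ dist x y) ∧
      A ⊆ ⋃ x : P, closedBall (x : X) δ := by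
  classical
  let S : Set ℕ := {n | ∃ P : Finset X, ↑P ⊆ A ∧
    (↑P : Set X).Pairwise (fun x y => δ ≤ dist x y) ∧ P.card = n}
  have hS : S.Nonempty := ⟨0, ∅, by simp, by simp, rfl⟩
  have hSb : BddAbove S := ⟨N, by rintro n ⟨P, h1, h2, rfl⟩; exact h P h1 h2⟩
  obtain ⟨P, hPA, hP, hcard⟩ := Nat.sSup_mem hS hSb
  refine ⟨P, hPA, hP, fun z hz => ?_⟩
  by_contra hcon
  simp only [mem_iUnion, not_exists, mem_closedBall, not_le] at hcon
  have hzP : z ∉ P := fun hzP => by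
    have := hcon ⟨z, hzP⟩
    rw [dist_self] at this
    linarith
  have : (insert z P).card ∈ S := by
    refine ⟨insert z P, ?_, ?_, rfl⟩
    · rw [Finset.coe_insert]
      exact insert_subset hz hPA
    · rw [Finset.coe_insert]
      refine hP.insert fun y hy _ => ?_
      have := (hcon ⟨y, hy⟩).le
      exact ⟨this, by rwa [dist_comm]⟩
  have h1 := le_csSup hSb this
  rw [Finset.card_insert_of_notMem hzP] at h1
  omega

variable [MeasurableSpace X] [BorelSpace X]

/-- If the fibres over an interval of a Lipschitz function on `A` contain connected sets which are
not too small, then the two-dimensional measure of `A` is not too small. -/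
theorem mul_le_hausdorffMeasure_two_of_slices {A : Set X} {f : X → ℝ} {K : ℝ≥0}
    (hf : LipschitzOnWith K f A) {u₁ u₂ ρ : ℝ}
    (h : ∀ u ∈ Icc u₁ u₂, ∃ E ⊆ A, IsPreconnected E ∧ (∀ x ∈ E, f x = u) ∧
      ∃ x ∈ E, ∃ y ∈ E, ρ ≤ dist x y) :
    ENNReal.ofReal ρ * ENNReal.ofReal (u₂ - u₁) ≤ K * μH[2] A := by
  have key : ∀ t : ℕ → Set X, A ⊆ ⋃ n, t n →
      ENNReal.ofReal ρ * ENNReal.ofReal (u₂ - u₁) ≤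
        K * ∑' n, ⨆ _ : (t n).Nonempty, ediam (t n) ^ (2 : ℝ) := by
    intro t ht
    -- The images need not be measurable, so measurable hulls of the same volume replace them.
    let I : ℕ → Set ℝ := fun n => toMeasurable volume (f '' (t n ∩ A))
    have hI : ∀ n, volume (I n) ≤ K * ediam (t n) := fun n => by
      rw [measure_toMeasurable]
      have := (hf.mono (inter_subset_right (s := t n))).holderOnWith.ediam_image_le
      refine (Real.volume_le_diam _).trans (this.trans ?_)
      rw [NNReal.coe_one, ENNReal.rpow_one]
      gcongr
      exact inter_subset_left
    -- Over each `u` the covering sets that meet the connected set in the fibre have total diameter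
    -- at least `ρ`. Integrating in `u` weights each diameter by the length of its image, at most
    -- `K` times that diameter.
    have hpt : ∀ u ∈ Icc u₁ u₂,
        ENNReal.ofReal ρ ≤ ∑' n, (I n).indicator (fun _ => ediam (t n)) u := by
      intro u hu
      obtain ⟨E, hEA, hE, hEu, x, hx, y, hy, hxy⟩ := h u hu
      calc ENNReal.ofReal ρ ≤ edist x y := by
            rw [edist_dist]; exact ENNReal.ofReal_le_ofReal hxy
        _ ≤ ∑' n, ediam (t n ∩ E) := le_tsum_ediam_of_isPreconnected hE hx hy (hEA.trans ht)
        _ ≤ _ := by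
            refine ENNReal.tsum_le_tsum fun n => ?_
            rcases (t n ∩ E).eq_empty_or_nonempty with h0 | ⟨z, hzt, hzE⟩
            · simp [h0]
            · have : u ∈ I n := subset_toMeasurable _ _ ⟨z, ⟨hzt, hEA hzE⟩, hEu z hzE⟩
              rw [indicator_of_mem this]
              exact ediam_mono inter_subset_left
    calc ENNReal.ofReal ρ * ENNReal.ofReal (u₂ - u₁)
        = ∫⁻ _ in Icc u₁ u₂, ENNReal.ofReal ρ := by
          rw [setLIntegral_const, Real.volume_Icc]
      _ ≤ ∫⁻ u in Icc u₁ u₂, ∑' n, (I n).indicator (fun _ => ediam (t n)) u :=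
          setLIntegral_mono' measurableSet_Icc hpt
      _ ≤ ∫⁻ u, ∑' n, (I n).indicator (fun _ => ediam (t n)) u := setLIntegral_le_lintegral _ _
      _ = ∑' n, ∫⁻ u, (I n).indicator (fun _ => ediam (t n)) u :=
          lintegral_tsum fun n =>
            (measurable_const.indicator (measurableSet_toMeasurable _ _)).aemeasurable
      _ = ∑' n, ediam (t n) * volume (I n) := by
          congr 1 with n
          rw [lintegral_indicator_const (measurableSet_toMeasurable _ _)]
      _ ≤ ∑' n, K * ⨆ _ : (t n).Nonempty, ediam (t n) ^ (2 : ℝ) := by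
          refine ENNReal.tsum_le_tsum fun n => ?_
          rcases (t n).eq_empty_or_nonempty with h0 | h0
          · simp [h0]
          · rw [ciSup_pos h0, ENNReal.rpow_two, sq]
            calc ediam (t n) * volume (I n) ≤ ediam (t n) * (K * ediam (t n)) := by
                  gcongr; exact hI n
              _ = _ := by ring
      _ = _ := ENNReal.tsum_mul_left
  rw [hausdorffMeasure_apply]
  by_cases hK : (K : ℝ≥0∞) = 0
  · simpa [hK] using key (fun _ => univ) (by simp [iUnion_const])
  rw [mul_comm (K : ℝ≥0∞), ← ENNReal.div_le_iff hK ENNReal.coe_ne_top]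
  -- The scale 1 is arbitrary: `key` holds for covers by sets of any size.
  refine le_trans ?_ (le_iSup₂ (α := ℝ≥0∞) 1 one_pos)
  refine le_iInf fun t => le_iInf fun ht => le_iInf fun _ => ?_
  rw [ENNReal.div_le_iff hK ENNReal.coe_ne_top, mul_comm _ (K : ℝ≥0∞)]
  exact key t ht

/-- A quadratic bound for packings bounds the two-dimensional measure. -/
theorem hausdorffMeasure_two_le_of_packing {A : Set X} {M δ₀ : ℝ} (hδ₀ : 0 < δ₀)
    (h : ∀ δ, 0 < δ → δ ≤ δ₀ → ∀ P : Finset X, ↑P ⊆ A →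
      (↑P : Set X).Pairwise (fun x y => δ ≤ dist x y) → (P.card : ℝ) * δ ^ 2 ≤ M) :
    μH[2] A ≤ ENNReal.ofReal (4 * M) := by
  let δ : ℕ → ℝ := fun n => δ₀ / (n + 1)
  have hδ : ∀ n, 0 < δ n := fun n => by positivity
  have hδle : ∀ n, δ n ≤ δ₀ := fun n => div_le_self hδ₀.le (by linarith [n.cast_nonneg (α := ℝ)])
  have hmax : ∀ n, ∃ P : Finset X, ↑P ⊆ A ∧
      (↑P : Set X).Pairwise (fun x y => δ n ≤ dist x y) ∧
      A ⊆ ⋃ x : P, closedBall (x : X) (δ n) := fun n => by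
    refine exists_maximal_separated (hδ n) (N := ⌊M / (δ n) ^ 2⌋₊) fun P hPA hP => ?_
    exact Nat.le_floor ((le_div_iff₀ (pow_pos (hδ n) 2)).2 (h _ (hδ n) (hδle n) P hPA hP))
  choose P hPA hP hcov using hmax
  have hdiam : ∀ n, ∀ i : P n, ediam (closedBall (i : X) (δ n)) ≤ ENNReal.ofReal (2 * δ n) :=
    fun n i => by
      refine ediam_le_of_forall_dist_le fun y hy z hz => ?_
      rw [mem_closedBall] at hy hz
      linarith [dist_triangle_right y z i]
  have hlim : Tendsto (fun n => ENNReal.ofReal (2 * δ n)) atTop (𝓝 0) := by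
    have : Tendsto (fun n : ℕ => 2 * δ n) atTop (𝓝 (2 * 0)) := by
      refine Tendsto.const_mul 2 ?_
      simpa [δ, div_eq_mul_one_div δ₀] using
        (tendsto_one_div_add_atTop_nhds_zero_nat (𝕜 := ℝ)).const_mul δ₀
    simpa using ENNReal.tendsto_ofReal this
  refine (hausdorffMeasure_le_liminf_sum 2 A _ hlim (fun n (i : P n) => closedBall (i : X) (δ n))
    (Eventually.of_forall hdiam) (Eventually.of_forall hcov)).trans ?_
  refine (liminf_le_liminf (v := fun _ => ENNReal.ofReal (4 * M)) (Eventually.of_forall fun n => ?_)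
    (by isBoundedDefault) (by isBoundedDefault)).trans (liminf_const _).le
  calc ∑ i : P n, ediam (closedBall (i : X) (δ n)) ^ (2 : ℝ)
      ≤ ∑ i : P n, ENNReal.ofReal ((2 * δ n) ^ 2) := by
        refine Finset.sum_le_sum fun i _ => ?_
        rw [ENNReal.rpow_two, ENNReal.ofReal_pow (by linarith [hδ n])]
        gcongr
        exact hdiam n i
    _ = ENNReal.ofReal ((P n).card * (2 * δ n) ^ 2) := by
        rw [Finset.sum_const, Finset.card_univ, Fintype.card_coe, nsmul_eq_mul,
          ENNReal.ofReal_mul (by positivity), ENNReal.ofReal_natCast]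
    _ ≤ ENNReal.ofReal (4 * M) := by
        refine ENNReal.ofReal_le_ofReal ?_
        have := h _ (hδ n) (hδle n) (P n) (hPA n) (hP n)
        linarith

end HausdorffMeasure

theorem hausdorffMeasure_pi_fin_two :
    (Measure.hausdorffMeasure 2 : Measure (Fin 2 → ℝ)) = volume := by
  have := hausdorffMeasure_pi_real (ι := Fin 2)
  simpa using this

/-- The sup-norm ball of area `4 * r ^ 2` contains the disc, and passing from the sup norm to the
Euclidean one costs a factor `√2 ^ 2`. -/
theorem hausdorffMeasure_two_ball_plane_le (x : Plane) {r : ℝ} (hr : 0 < r) :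
    Measure.hausdorffMeasure 2 (Metric.ball x r) ≤ ENNReal.ofReal (8 * r ^ 2) := by
  have h1 : LipschitzWith (NNReal.sqrt 2) (WithLp.toLp 2 : (Fin 2 → ℝ) → Plane) := by
    have := PiLp.lipschitzWith_toLp 2 (fun _ : Fin 2 => ℝ)
    refine this.weaken (le_of_eq ?_)
    rw [NNReal.sqrt_eq_rpow]
    simp
  have h2 : Metric.ball x r ⊆ (WithLp.toLp 2 : (Fin 2 → ℝ) → Plane) ''
      Metric.ball (WithLp.ofLp x) r := by
    intro y hy
    refine ⟨WithLp.ofLp y, ?_, rfl⟩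
    have := (PiLp.lipschitzWith_ofLp 2 (fun _ : Fin 2 => ℝ)).dist_le_mul y x
    rw [Metric.mem_ball] at hy ⊢
    simp only [NNReal.coe_one, one_mul] at this
    exact this.trans_lt hy
  calc _ ≤ _ := measure_mono h2
    _ ≤ _ := h1.hausdorffMeasure_image_le (by norm_num) _
    _ = ENNReal.ofReal (8 * r ^ 2) := by
      rw [hausdorffMeasure_pi_fin_two, Real.volume_pi_ball _ hr, ENNReal.rpow_two,
        ← ENNReal.coe_pow, NNReal.sq_sqrt, ENNReal.coe_ofNat,
        ← ENNReal.ofReal_ofNat 2, ← ENNReal.ofReal_mul (by norm_num)]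
      congr 1
      simp
      ring

theorem le_hausdorffMeasure_two_ball_plane (x : Plane) {r : ℝ} (hr : 0 < r) :
    ENNReal.ofReal (r ^ 2) ≤ Measure.hausdorffMeasure 2 (Metric.ball x r) := by
  have h1 : LipschitzWith 1 (WithLp.ofLp : Plane → (Fin 2 → ℝ)) :=
    PiLp.lipschitzWith_ofLp 2 (fun _ : Fin 2 => ℝ)
  have h2 : Metric.ball (WithLp.ofLp x) (r / 2) ⊆
      (WithLp.ofLp : Plane → (Fin 2 → ℝ)) '' Metric.ball x r := by
    intro y hy
    refine ⟨WithLp.toLp 2 y, ?_, rfl⟩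
    have h0 := fun i => (dist_le_pi_dist y (WithLp.ofLp x) i).trans_lt hy
    rw [Metric.mem_ball, EuclideanSpace.dist_eq, Real.sqrt_lt' hr, Fin.sum_univ_two]
    have h0' := h0 0
    have h1' := h0 1
    simp only
    nlinarith [dist_nonneg (x := y 0) (y := x 0), dist_nonneg (x := y 1) (y := x 1)]
  have h3 := (measure_mono h2).trans (h1.hausdorffMeasure_image_le (d := 2) (by norm_num) _)
  rw [hausdorffMeasure_pi_fin_two, Real.volume_pi_ball _ (by positivity)] at h3
  simp only [ENNReal.coe_one, ENNReal.one_rpow, one_mul] at h3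
  refine le_trans (le_of_eq ?_) h3
  congr 1
  simp
  ring

/-! ### Chord-arc curves -/

/-- Each gap between consecutive parameters contributes `δ` to the variation; there is one gap fewer
than there are points. -/
theorem card_mul_le_eVariationOn_add {g : ℝ → Plane} {δ : ℝ} {T : Finset ℝ}
    (hsep : (↑T : Set ℝ).Pairwise fun s t => δ ≤ dist (g s) (g t)) {a b : ℝ}
    (hT : ∀ t ∈ T, t ∈ Icc a b) :
    T.card * ENNReal.ofReal δ ≤ eVariationOn g (Icc a b) + ENNReal.ofReal δ := by
  classical
  induction T using Finset.induction_on_max generalizing b with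
  | empty => simp
  | insert x T hx ih =>
    have hxT : x ∉ T := fun h => lt_irrefl _ (hx x h)
    rw [Finset.card_insert_of_notMem hxT]
    push_cast
    rw [add_mul, one_mul]
    gcongr
    rcases T.eq_empty_or_nonempty with rfl | hne
    · simp
    · set y := T.max' hne with hy
      have hyT : y ∈ T := T.max'_mem hne
      have hyx : y < x := hx y hyT
      have hxb := hT x (Finset.mem_insert_self _ _)
      have hyb := hT y (Finset.mem_insert_of_mem hyT)
      have h1 := ih (b := y) (hsep.mono (by simp))
        (fun t ht => ⟨(hT t (Finset.mem_insert_of_mem ht)).1, T.le_max' t ht⟩)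
      have h2 : ENNReal.ofReal δ ≤ eVariationOn g (Icc y b) := by
        refine le_trans ?_ (eVariationOn.edist_le g (x := y) (y := x) ⟨le_rfl, hyb.2⟩ ⟨hyx.le, hxb.2⟩)
        rw [edist_dist]
        exact ENNReal.ofReal_le_ofReal (hsep (by simp [hyT]) (by simp) hyx.ne)
      have h3 : eVariationOn g (Icc a y) + eVariationOn g (Icc y b) ≤ eVariationOn g (Icc a b) := by
        refine (eVariationOn.add_le_union g fun s hs t ht => hs.2.trans ht.1).trans
          (eVariationOn.mono g ?_)
        exact union_subset (Icc_subset_Icc_right hyb.2) (Icc_subset_Icc_left hyb.1)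
      exact h1.trans ((add_le_add_right h2 _).trans h3)

/-- A bounded part of a chord-arc curve has at most linearly many separated points. -/
theorem IsChordArcCurve.card_mul_le {c : ℝ} {S : Set Plane} (h : IsChordArcCurve c S)
    (hc : 0 ≤ c) {P : Finset Plane} (hPS : ↑P ⊆ S) {δ D : ℝ} (hδ : 0 < δ) (hD : 0 ≤ D)
    (hsep : (↑P : Set Plane).Pairwise fun x y => δ ≤ dist x y)
    (hdist : ∀ x ∈ P, ∀ y ∈ P, dist x y ≤ D) :
    P.card * δ ≤ 2 * (c * D + δ) := by
  classical
  obtain ⟨g, ⟨-, -, -, himg⟩, -, hca⟩ := h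
  rcases P.eq_empty_or_nonempty with rfl | hPne
  · simp; positivity
  have hex : ∀ y, ∃ t, y ∈ P → t ∈ Icc (0 : ℝ) 1 ∧ g t = y := fun y => by
    by_cases hy : y ∈ P
    · obtain ⟨t, ht, rfl⟩ := himg.symm ▸ hPS hy
      exact ⟨t, fun _ => ⟨ht, rfl⟩⟩
    · exact ⟨0, fun h => absurd h hy⟩
  choose τ hτ using hex
  have hinj : Set.InjOn τ P := fun x hx y hy hxy => by
    rw [← (hτ x hx).2, ← (hτ y hy).2, hxy]
  set T := P.image τ with hT
  have hTcard : T.card = P.card := Finset.card_image_of_injOn hinj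
  have hTne : T.Nonempty := hPne.image τ
  have hT01 : ∀ t ∈ T, t ∈ Icc (0 : ℝ) 1 ∧ g t ∈ P := fun t ht => by
    obtain ⟨y, hy, rfl⟩ := Finset.mem_image.1 ht
    rw [(hτ y hy).2]
    exact ⟨(hτ y hy).1, hy⟩
  have hTsep : (↑T : Set ℝ).Pairwise fun s t => δ ≤ dist (g s) (g t) := by
    intro s hs t ht hst
    obtain ⟨x, hx, rfl⟩ := Finset.mem_image.1 hs
    obtain ⟨y, hy, rfl⟩ := Finset.mem_image.1 ht
    rw [(hτ x hx).2, (hτ y hy).2]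
    exact hsep hx hy (fun h => hst (h ▸ rfl))
  set m := T.min' hTne with hm
  have hmT : m ∈ T := T.min'_mem hTne
  set V := ENNReal.ofReal (c * D) with hV
  -- The chord-arc condition is applied from the first parameter `m` only: either `[m, t]` or `[t,
  -- 1]` is short. The parameters of the first kind lie in one short interval ending at their
  -- maximum, the others in one starting at their minimum.
  have hmin : ∀ t ∈ T, eVariationOn g (Icc m t) ≤ V ∨ eVariationOn g (Icc t 1) ≤ V := by
    intro t ht
    have h1 := hca m t (hT01 m hmT).1.1 (T.min'_le t ht) (hT01 t ht).1.2
    have h2 : ENNReal.ofReal (c * dist (g m) (g t)) ≤ V := by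
      refine ENNReal.ofReal_le_ofReal (mul_le_mul_of_nonneg_left ?_ hc)
      exact hdist _ (hT01 m hmT).2 _ (hT01 t ht).2
    rcases min_le_iff.1 (h1.trans h2) with h3 | h3
    · exact Or.inl h3
    · exact Or.inr (le_add_self.trans h3)
  have hpart : ∀ T' ⊆ T, (∃ a b, (∀ t ∈ T', t ∈ Icc a b) ∧ eVariationOn g (Icc a b) ≤ V) →
      T'.card * δ ≤ c * D + δ := by
    rintro T' hT' ⟨a, b, hab, hVab⟩
    have h1 := (card_mul_le_eVariationOn_add
      (hTsep.mono (Finset.coe_subset.2 hT')) hab).trans (add_le_add_left hVab _)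
    rw [hV, ← ENNReal.ofReal_add (by positivity) hδ.le, ← ENNReal.ofReal_natCast,
      ← ENNReal.ofReal_mul (by positivity)] at h1
    exact (ENNReal.ofReal_le_ofReal_iff (by positivity)).1 h1
  set T₁ := T.filter fun t => eVariationOn g (Icc m t) ≤ V with hT₁
  set T₂ := T.filter fun t => ¬ eVariationOn g (Icc m t) ≤ V with hT₂
  have hsum : T₁.card + T₂.card = T.card := Finset.card_filter_add_card_filter_not _
  have hpos : 0 ≤ c * D + δ := by positivity
  have hb₁ : T₁.card * δ ≤ c * D + δ := by
    rcases T₁.eq_empty_or_nonempty with h0 | h0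
    · simpa [h0] using hpos
    · refine hpart T₁ (Finset.filter_subset _ _) ⟨m, T₁.max' h0, fun t ht =>
        ⟨T.min'_le t (Finset.filter_subset _ _ ht), T₁.le_max' t ht⟩, ?_⟩
      exact (Finset.mem_filter.1 (T₁.max'_mem h0)).2
  have hb₂ : T₂.card * δ ≤ c * D + δ := by
    rcases T₂.eq_empty_or_nonempty with h0 | h0
    · simpa [h0] using hpos
    · refine hpart T₂ (Finset.filter_subset _ _) ⟨T₂.min' h0, 1, fun t ht =>
        ⟨T₂.min'_le t ht, (hT01 t (Finset.filter_subset _ _ ht)).1.2⟩, ?_⟩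
      have := Finset.mem_filter.1 (T₂.min'_mem h0)
      exact (hmin _ this.1).resolve_left this.2
  rw [← hTcard, ← hsum]
  push_cast
  linarith

/-- Chord-arc curves are of bounded turning. -/
theorem IsChordArcCurve.exists_isPreconnected {c : ℝ} {S : Set Plane} (h : IsChordArcCurve c S)
    (hc : 0 ≤ c) {u v : Plane} (hu : u ∈ S) (hv : v ∈ S) :
    ∃ J ⊆ S, IsPreconnected J ∧ u ∈ J ∧ v ∈ J ∧ ∀ x ∈ J, ∀ y ∈ J, dist x y ≤ c * dist u v := by
  obtain ⟨g, ⟨hg, hcl, -, rfl⟩, -, hca⟩ := h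
  have key : ∀ s t, 0 ≤ s → s ≤ t → t ≤ 1 → ∃ J ⊆ g '' Icc 0 1, IsPreconnected J ∧ g s ∈ J ∧
      g t ∈ J ∧ ∀ x ∈ J, ∀ y ∈ J, dist x y ≤ c * dist (g s) (g t) := by
    intro s t hs hst ht
    have hreal : ∀ x y : Plane, edist x y ≤ ENNReal.ofReal (c * dist (g s) (g t)) →
        dist x y ≤ c * dist (g s) (g t) := fun x y h => by
      rwa [edist_dist, ENNReal.ofReal_le_ofReal_iff (by positivity)] at h
    rcases min_le_iff.1 (hca s t hs hst ht) with h1 | h1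
    · have hsub : Icc s t ⊆ Icc 0 1 := Icc_subset_Icc hs ht
      refine ⟨g '' Icc s t, image_mono hsub, isPreconnected_Icc.image g (hg.mono hsub),
        mem_image_of_mem g ⟨le_rfl, hst⟩, mem_image_of_mem g ⟨hst, le_rfl⟩, ?_⟩
      rintro _ ⟨a, ha, rfl⟩ _ ⟨b, hb, rfl⟩
      exact hreal _ _ ((eVariationOn.edist_le g ha hb).trans h1)
    · have hsub1 : Icc 0 s ⊆ Icc (0 : ℝ) 1 := Icc_subset_Icc_right (hst.trans ht)
      have hsub2 : Icc t 1 ⊆ Icc (0 : ℝ) 1 := Icc_subset_Icc_left (hs.trans hst)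
      refine ⟨g '' Icc 0 s ∪ g '' Icc t 1, union_subset (image_mono hsub1) (image_mono hsub2),
        IsPreconnected.union (g 0) (mem_image_of_mem g ⟨le_rfl, hs⟩)
          (hcl ▸ mem_image_of_mem g ⟨ht, le_rfl⟩) (isPreconnected_Icc.image g (hg.mono hsub1))
          (isPreconnected_Icc.image g (hg.mono hsub2)),
        Or.inl (mem_image_of_mem g ⟨hs, le_rfl⟩), Or.inr (mem_image_of_mem g ⟨le_rfl, ht⟩), ?_⟩
      have hcross : ∀ a ∈ Icc 0 s, ∀ b ∈ Icc t 1, edist (g a) (g b) ≤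
          eVariationOn g (Icc 0 s) + eVariationOn g (Icc t 1) := fun a ha b hb => by
        refine (edist_triangle (g a) (g 0) (g b)).trans (add_le_add
          (eVariationOn.edist_le g ha ⟨le_rfl, hs⟩) ?_)
        rw [hcl]
        exact eVariationOn.edist_le g ⟨ht, le_rfl⟩ hb
      rintro _ (⟨a, ha, rfl⟩ | ⟨a, ha, rfl⟩) _ (⟨b, hb, rfl⟩ | ⟨b, hb, rfl⟩)
      · exact hreal _ _ (((eVariationOn.edist_le g ha hb).trans le_self_add).trans h1)
      · exact hreal _ _ ((hcross a ha b hb).trans h1)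
      · rw [dist_comm (g a)]
        exact hreal _ _ ((hcross b hb a ha).trans h1)
      · exact hreal _ _ (((eVariationOn.edist_le g ha hb).trans le_add_self).trans h1)
  obtain ⟨s, hs, rfl⟩ := hu
  obtain ⟨t, ht, rfl⟩ := hv
  rcases le_total s t with hst | hst
  · exact key s t hs.1 hst ht.2
  · obtain ⟨J, h1, h2, h3, h4, h5⟩ := key t s ht.1 hst hs.2
    exact ⟨J, h1, h2, h4, h3, by rwa [dist_comm (g s)]⟩

/-- Follow the curve from `y` towards `y'` and stop when the distance `ρ` is first reached. -/
theorem IsJordanCurve.exists_isPreconnected_in_closedBall {S : Set Plane} (h : IsJordanCurve S)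
    {y y' : Plane} (hy : y ∈ S) (hy' : y' ∈ S) {ρ : ℝ} (hρ : 0 ≤ ρ) (hd : ρ ≤ dist y y') :
    ∃ E ⊆ S, IsPreconnected E ∧ y ∈ E ∧ (∃ z ∈ E, ρ ≤ dist y z) ∧ ∀ x ∈ E, dist x y ≤ ρ := by
  obtain ⟨g, hg, -, -, rfl⟩ := h
  obtain ⟨a, ha, rfl⟩ := hy
  obtain ⟨b, hb, rfl⟩ := hy'
  let l : ℝ → ℝ := fun τ => a + τ * (b - a)
  have hl : MapsTo l (Icc 0 1) (Icc 0 1) := fun τ hτ => by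
    constructor
    · have := mul_nonneg hτ.1 hb.1
      have := mul_nonneg (sub_nonneg.2 hτ.2) ha.1
      simp only [l]; linarith
    · have := mul_nonneg hτ.1 (sub_nonneg.2 hb.2)
      have := mul_nonneg (sub_nonneg.2 hτ.2) (sub_nonneg.2 ha.2)
      simp only [l]; linarith
  let G : ℝ → Plane := g ∘ l
  have hG : ContinuousOn G (Icc 0 1) := hg.comp (by fun_prop) hl
  have hG0 : G 0 = g a := by simp [G, l]
  have hG1 : G 1 = g b := by simp [G, l]
  let D : ℝ → ℝ := fun τ => dist (g a) (G τ)
  have hD : ContinuousOn D (Icc 0 1) := Continuous.comp_continuousOn (by fun_prop) hG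
  have hcpt : IsCompact (Icc 0 1 ∩ D ⁻¹' Ici ρ) :=
    isCompact_Icc.of_isClosed_subset (hD.preimage_isClosed_of_isClosed isClosed_Icc isClosed_Ici)
      inter_subset_left
  obtain ⟨τ, ⟨hτ, hτρ⟩, hleast⟩ := hcpt.exists_isLeast
    ⟨1, ⟨zero_le_one, le_rfl⟩, by simpa [D, hG1] using hd⟩
  have hsub : Icc 0 τ ⊆ Icc (0 : ℝ) 1 := Icc_subset_Icc_right hτ.2
  refine ⟨G '' Icc 0 τ, ?_, isPreconnected_Icc.image G (hG.mono hsub),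
    ⟨0, ⟨le_rfl, hτ.1⟩, hG0⟩, ⟨G τ, mem_image_of_mem G ⟨hτ.1, le_rfl⟩, hτρ⟩, ?_⟩
  · rintro _ ⟨σ, hσ, rfl⟩
    exact mem_image_of_mem g (hl (hsub hσ))
  · rintro _ ⟨σ, hσ, rfl⟩
    by_contra! hcon
    rw [dist_comm] at hcon
    have hσ1 : Icc 0 σ ⊆ Icc (0 : ℝ) 1 := Icc_subset_Icc_right (hsub hσ).2
    obtain ⟨σ', hσ', hσ'ρ⟩ := intermediate_value_Icc hσ.1 (hD.mono hσ1)
      (show ρ ∈ Icc (D 0) (D σ) from ⟨by simpa [D, hG0] using hρ, hcon.le⟩)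
    have h1 : τ ≤ σ' := hleast ⟨hσ1 hσ', hσ'ρ.ge⟩
    have h2 : σ' = σ := le_antisymm hσ'.2 (hσ.2.trans h1)
    rw [h2] at hσ'ρ
    exact hcon.ne' hσ'ρ

/-! ### Level sets of the distance to the boundary -/

theorem _root_.IsPreconnected.inter_frontier_nonempty_of_mem_of_notMem {X : Type*}
    [TopologicalSpace X] {s A : Set X} (hs : IsPreconnected s) {x y : X} (hx : x ∈ s) (hxA : x ∈ A)
    (hy : y ∈ s) (hyA : y ∉ A) : (s ∩ frontier A).Nonempty := by
  by_contra hcon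
  have hn : ∀ z ∈ s, z ∉ frontier A := fun z hz hzA => hcon ⟨z, hz, hzA⟩
  have hxi : x ∈ interior A := by
    by_contra h
    exact hn x hx ⟨subset_closure hxA, h⟩
  have hyc : y ∈ (closure A)ᶜ := fun h => hn y hy ⟨h, fun h' => hyA (interior_subset h')⟩
  obtain ⟨z, -, hz1, hz2⟩ := hs _ _ isOpen_interior isClosed_closure.isOpen_compl
    (fun z hz => by
      by_cases h : z ∈ closure A
      · left; by_contra h'; exact hn z hz ⟨h, h'⟩
      · exact Or.inr h) ⟨x, hx, hxi⟩ ⟨y, hy, hyc⟩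
  exact hz2 (subset_closure (interior_subset hz1))

theorem coe_bdist (Ω : Set Plane) (x : Plane) :
    (bdist Ω x : ℝ) = Metric.infDist x (_root_.frontier Ω) := rfl

theorem lipschitzWith_bdist (Ω : Set Plane) : LipschitzWith 1 (bdist Ω) :=
  Metric.lipschitz_infNndist_pt _

theorem bdist_le_add (Ω : Set Plane) (x y : Plane) : (bdist Ω x : ℝ) ≤ bdist Ω y + dist x y :=
  Metric.infDist_le_infDist_add_dist

theorem IsJordanDomain.frontier_nonempty {Ω : Set Plane} (h : IsJordanDomain Ω) :
    (_root_.frontier Ω).Nonempty := by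
  obtain ⟨g, hg⟩ := h.frontier
  rw [← hg.image_eq]
  exact ⟨g 0, 0, by simp, rfl⟩

theorem IsJordanDomain.levelSet_zero {Ω : Set Plane} (h : IsJordanDomain Ω) :
    levelSet Ω 0 = _root_.frontier Ω := by
  ext x
  rw [isClosed_frontier.mem_iff_infDist_zero h.frontier_nonempty, ← coe_bdist]
  simp only [levelSet, mem_ofPred_eq, NNReal.coe_eq_zero, and_iff_right_iff_imp]
  intro h0
  have : x ∈ _root_.frontier Ω := by
    rw [isClosed_frontier.mem_iff_infDist_zero h.frontier_nonempty, ← coe_bdist, h0]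
    rfl
  exact frontier_subset_closure this

theorem IsJordanDomain.isCompact_frontier {Ω : Set Plane} (h : IsJordanDomain Ω) :
    IsCompact (_root_.frontier Ω) :=
  Metric.isCompact_of_isClosed_isBounded isClosed_frontier
    (h.isBounded.closure.subset frontier_subset_closure)

theorem IsJordanDomain.exists_dist_eq_bdist {Ω : Set Plane} (h : IsJordanDomain Ω) (x : Plane) :
    ∃ p ∈ _root_.frontier Ω, dist x p = bdist Ω x := by
  obtain ⟨p, hp, hd⟩ := h.isCompact_frontier.exists_infDist_eq_dist h.frontier_nonempty x
  exact ⟨p, hp, hd.symm⟩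

theorem IsJordanDomain.mem_of_bdist_pos {Ω : Set Plane} (h : IsJordanDomain Ω) {x : Plane}
    (hx : x ∈ closure Ω) (h0 : 0 < bdist Ω x) : x ∈ Ω := by
  by_contra hcon
  have hfr : x ∈ _root_.frontier Ω := ⟨hx, fun h' => hcon (interior_subset h')⟩
  rw [isClosed_frontier.mem_iff_infDist_zero h.frontier_nonempty, ← coe_bdist] at hfr
  exact h0.ne' (by exact_mod_cast hfr)

theorem IsJordanDomain.ball_subset {Ω : Set Plane} (h : IsJordanDomain Ω) {x : Plane}
    (hx : x ∈ closure Ω) : Metric.ball x (bdist Ω x) ⊆ Ω := by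
  intro y hy
  have hpos : 0 < (bdist Ω x : ℝ) := dist_nonneg.trans_lt hy
  have hxΩ := h.mem_of_bdist_pos hx (by exact_mod_cast hpos)
  by_contra hyΩ
  obtain ⟨z, hz, hzf⟩ := (convex_ball x (bdist Ω x : ℝ)).isPreconnected
    |>.inter_frontier_nonempty_of_mem_of_notMem (Metric.mem_ball_self hpos) hxΩ hy hyΩ
  have := Metric.infDist_le_dist_of_mem hzf (x := x)
  rw [Metric.mem_ball, dist_comm, coe_bdist] at hz
  linarith

/-- Moving towards the nearest boundary point one meets all lower level sets. -/
theorem IsJordanDomain.exists_mem_levelSet_dist_le {Ω : Set Plane} (h : IsJordanDomain Ω)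
    {x : Plane} (hx : x ∈ closure Ω) {s : ℝ≥0} (hs : s ≤ bdist Ω x) :
    ∃ y ∈ levelSet Ω s, dist y x ≤ bdist Ω x - s := by
  rcases eq_or_lt_of_le (zero_le (a := bdist Ω x)) with h0 | h0
  · have : s = bdist Ω x := le_antisymm hs (h0 ▸ zero_le)
    exact ⟨x, ⟨hx, this.symm⟩, by simp [this]⟩
  obtain ⟨p, hp, hpd⟩ := h.exists_dist_eq_bdist x
  set t := bdist Ω x with ht
  have h0' : (0 : ℝ) < t := by exact_mod_cast h0
  have hst : (s : ℝ) ≤ t := by exact_mod_cast hs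
  set lam : ℝ := (t - s) / t with hlam
  have hlam0 : 0 ≤ lam := div_nonneg (by linarith) h0'.le
  have hlamt : lam * t = t - s := by rw [hlam]; field_simp
  -- The point of the segment at distance `s` from `p`: its boundary distance is at most `s` because
  -- of `p`, and at least `s` by the Lipschitz property.
  set y := AffineMap.lineMap x p lam with hy
  have hyx : dist y x = t - s := by
    rw [hy, dist_lineMap_left, hpd, Real.norm_eq_abs, abs_of_nonneg hlam0, hlamt]
  have hyp : dist y p = s := by
    rw [hy, dist_lineMap_right, hpd, Real.norm_eq_abs, abs_of_nonneg, sub_mul, hlamt]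
    · ring
    · rw [sub_nonneg, hlam, div_le_one h0']
      linarith [s.coe_nonneg]
  have h1 : (bdist Ω y : ℝ) ≤ s := hyp ▸ Metric.infDist_le_dist_of_mem hp
  have h2 : (s : ℝ) ≤ bdist Ω y := by
    have := bdist_le_add Ω x y
    rw [dist_comm, hyx] at this
    linarith
  refine ⟨y, ⟨?_, by exact_mod_cast le_antisymm h1 h2⟩, hyx.le⟩
  have h3 : y ∈ closure (Metric.ball x t) := by
    rw [closure_ball x h0'.ne', Metric.mem_closedBall, hyx]
    linarith [s.coe_nonneg]
  exact closure_mono (h.ball_subset hx) h3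

theorem frontier_inter_lt_bdist_subset_levelSet {Ω : Set Plane} (hΩ : IsOpen Ω) (s : ℝ≥0) :
    frontier (Ω ∩ {x | s < bdist Ω x}) ⊆ levelSet Ω s := by
  have hopen : IsOpen (Ω ∩ {x | s < bdist Ω x}) :=
    hΩ.inter (isOpen_lt continuous_const (lipschitzWith_bdist Ω).continuous)
  rintro x ⟨hx1, hx2⟩
  rw [hopen.interior_eq] at hx2
  have hxΩ : x ∈ closure Ω := closure_mono inter_subset_left hx1
  have hge : s ≤ bdist Ω x := by
    have hsub : Ω ∩ {x | s < bdist Ω x} ⊆ {x | s ≤ bdist Ω x} := fun z hz =>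
      le_of_lt (show s < bdist Ω z from hz.2)
    have : x ∈ closure {x | s ≤ bdist Ω x} := closure_mono hsub hx1
    rwa [(isClosed_le continuous_const (lipschitzWith_bdist Ω).continuous).closure_eq] at this
  refine ⟨hxΩ, le_antisymm ?_ hge⟩
  by_contra! hlt
  refine hx2 ⟨?_, hlt⟩
  by_contra hxn
  have hfr : x ∈ _root_.frontier Ω := ⟨hxΩ, fun h' => hxn (interior_subset h')⟩
  have h0 : bdist Ω x = 0 := by
    rw [← NNReal.coe_eq_zero, coe_bdist]
    exact Metric.infDist_zero_of_mem hfr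
  exact absurd hlt (by simp [h0])

/-- Level sets below the level of some point `x₀` of the domain are not small. -/
theorem IsJordanDomain.exists_mem_levelSet_le_dist {Ω : Set Plane} (h : IsJordanDomain Ω)
    {x₀ : Plane} (hx₀ : x₀ ∈ closure Ω) {s : ℝ≥0} (hs : s < bdist Ω x₀) {y : Plane}
    (hy : y ∈ levelSet Ω s) :
    ∃ y' ∈ levelSet Ω s, (bdist Ω x₀ : ℝ) - s ≤ dist y y' := by
  have hx₀Ω : x₀ ∈ Ω := h.mem_of_bdist_pos hx₀ (zero_le.trans_lt hs)
  have hyd : (bdist Ω x₀ : ℝ) - s ≤ dist x₀ y := by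
    have := bdist_le_add Ω x₀ y
    rw [hy.2] at this
    linarith
  have hs' : (s : ℝ) < bdist Ω x₀ := by exact_mod_cast hs
  have hdpos : 0 < dist x₀ y := by linarith
  obtain ⟨R, hR0, hR⟩ := h.isBounded.subset_ball_lt 0 x₀
  -- The ray from `y` through `x₀`, started at `x₀`. It must leave the superlevel set, at a point of
  -- the level set farther from `y` than `x₀` is.
  let l : ℝ → Plane := fun τ => AffineMap.lineMap y x₀ (1 + τ)
  have hl : Continuous l := by
    simp only [l]
    exact AffineMap.lineMap_continuous.comp (by fun_prop)
  have hl0 : l 0 = x₀ := by simp [l]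
  set M := R / dist x₀ y with hM
  have hM0 : 0 ≤ M := by positivity
  have hlM : l M ∉ Ω ∩ {x | s < bdist Ω x} := fun hm => by
    have h1 := hR hm.1
    rw [Metric.mem_ball] at h1
    have h2 : dist (l M) x₀ = R := by
      simp only [l]
      rw [dist_lineMap_right, dist_comm y, Real.norm_eq_abs]
      rw [show 1 - (1 + M) = -M by ring, abs_neg, abs_of_nonneg hM0, hM]
      field_simp
    linarith
  have hpre : IsPreconnected (l '' Icc 0 M) := isPreconnected_Icc.image l hl.continuousOn
  obtain ⟨z, ⟨τ, hτ, rfl⟩, hz⟩ := hpre.inter_frontier_nonempty_of_mem_of_notMem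
    (A := Ω ∩ {x | s < bdist Ω x}) ⟨0, ⟨le_rfl, hM0⟩, hl0⟩ ⟨hx₀Ω, hs⟩
    ⟨M, ⟨hM0, le_rfl⟩, rfl⟩ hlM
  refine ⟨l τ, frontier_inter_lt_bdist_subset_levelSet h.isOpen s hz, ?_⟩
  rw [dist_comm]
  simp only [l]
  rw [dist_lineMap_left, dist_comm y, Real.norm_eq_abs, abs_of_nonneg (by linarith [hτ.1])]
  nlinarith [hτ.1]

/-! ### The surface and its height function -/

/-- The point of space over `y` at height `z`. -/
def lift (y : Plane) (z : ℝ) : Space := !₂[y 0, y 1, z]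

@[simp] theorem proj_lift (y : Plane) (z : ℝ) : proj (lift y z) = y := by
  ext i; fin_cases i <;> rfl

@[simp] theorem lift_apply_two (y : Plane) (z : ℝ) : lift y z 2 = z := rfl

theorem lift_proj (p : Space) : lift (proj p) (p 2) = p := by
  ext i; fin_cases i <;> rfl

theorem dist_space_eq (p q : Space) :
    dist p q = √(dist (proj p) (proj q) ^ 2 + |p 2 - q 2| ^ 2) := by
  rw [EuclideanSpace.dist_eq, EuclideanSpace.dist_eq, Real.sq_sqrt (by positivity),
    Fin.sum_univ_three, Fin.sum_univ_two]
  rfl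

theorem dist_proj_le (p q : Space) : dist (proj p) (proj q) ≤ dist p q := by
  rw [dist_space_eq]
  exact Real.le_sqrt_of_sq_le (le_add_of_nonneg_right (sq_nonneg _))

theorem abs_sub_le_dist (p q : Space) : |p 2 - q 2| ≤ dist p q := by
  rw [dist_space_eq p q]
  exact Real.le_sqrt_of_sq_le (le_add_of_nonneg_left (sq_nonneg _))

theorem dist_le_dist_proj_add (p q : Space) :
    dist p q ≤ dist (proj p) (proj q) + |p 2 - q 2| := by
  rw [dist_space_eq p q]
  refine Real.sqrt_le_iff.2 ⟨by positivity, ?_⟩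
  nlinarith [dist_nonneg (x := proj p) (y := proj q), abs_nonneg (p 2 - q 2)]

theorem lipschitzWith_proj : LipschitzWith 1 proj :=
  LipschitzWith.of_dist_le_mul fun p q => by simpa using dist_proj_le p q

theorem continuous_lift (z : ℝ) : Continuous fun y => lift y z := by
  refine (LipschitzWith.of_dist_le_mul (K := 1) fun x y => ?_).continuous
  simpa using dist_le_dist_proj_add (lift x z) (lift y z)

theorem mem_surface_iff {Ω : Set Plane} {φ : ℝ≥0 → ℝ≥0} {p : Space} :
    p ∈ surface Ω φ ↔ proj p ∈ closure Ω ∧ |p 2| = φ (bdist Ω (proj p)) := by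
  rw [abs_eq (NNReal.coe_nonneg _)]
  rfl

/-- On the surface over `Ω` this is the sum of the distance to the boundary and its image by the
gauge. -/
noncomputable def height (Ω : Set Plane) (p : Space) : ℝ := bdist Ω (proj p) + |p 2|

theorem height_nonneg (Ω : Set Plane) (p : Space) : 0 ≤ height Ω p := by
  unfold height; positivity

theorem height_le_add (Ω : Set Plane) (p q : Space) :
    height Ω p ≤ height Ω q + 2 * dist p q := by
  have h1 := bdist_le_add Ω (proj p) (proj q)
  have h2 := dist_proj_le p q
  have h3 := (abs_sub_abs_le_abs_sub (p 2) (q 2)).trans (abs_sub_le_dist p q)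
  unfold height
  linarith

theorem lipschitzWith_height (Ω : Set Plane) : LipschitzWith 2 (height Ω) :=
  LipschitzWith.of_le_add_mul 2 fun p q => height_le_add Ω p q

theorem height_eq {Ω : Set Plane} {φ : ℝ≥0 → ℝ≥0} {p : Space} (hp : p ∈ surface Ω φ) :
    height Ω p = bdist Ω (proj p) + φ (bdist Ω (proj p)) := by
  rw [height, (mem_surface_iff.1 hp).2]

theorem IsGauge.strictMono {φ : ℝ≥0 → ℝ≥0} (h : IsGauge φ) : StrictMono φ := by
  rcases h.isHomeomorph.continuous.strictMono_of_inj h.isHomeomorph.injective with h1 | h1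
  · exact h1
  · have := h1 (zero_lt_one' ℝ≥0)
    rw [h.map_zero] at this
    exact absurd this not_lt_zero

theorem IsGauge.exists_add_eq {φ : ℝ≥0 → ℝ≥0} (h : IsGauge φ) {t : ℝ≥0} {u : ℝ} (hu : 0 ≤ u)
    (hut : u ≤ t + φ t) : ∃ s ≤ t, (s : ℝ) + φ s = u := by
  lift u to ℝ≥0 using hu
  have hcont : Continuous fun s => s + φ s := continuous_id.add h.isHomeomorph.continuous
  obtain ⟨s, hs, hsu⟩ := intermediate_value_Icc (zero_le (a := t)) hcont.continuousOn
    (show u ∈ Icc _ _ from ⟨by simp [h.map_zero], by exact_mod_cast hut⟩)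
  exact ⟨s, hs.2, by exact_mod_cast hsu⟩

theorem IsGauge.le_of_add_le {φ : ℝ≥0 → ℝ≥0} (h : IsGauge φ) {s t : ℝ≥0}
    (hst : (s : ℝ) + φ s ≤ t + φ t) : s ≤ t := by
  by_contra! hlt
  have h1 : (φ t : ℝ) < φ s := by exact_mod_cast h.strictMono hlt
  have h2 : (t : ℝ) < s := by exact_mod_cast hlt
  linarith

/-! ### The upper bound -/

section UpperBound

variable {Ω : Set Plane} {φ : ℝ≥0 → ℝ≥0} {c r δ : ℝ} {ε₀ : ℝ≥0} {a : Space}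

/-- All points of a slab of heights can be moved down to the level curve of height `u`, each by at
most `δ` in the plane. Their vertical coordinates also differ by at most `δ`, so separation in space
survives in the plane. -/
theorem card_mul_le_of_height_le (hΩ : IsJordanDomain Ω) (hφ : IsGauge φ) (hc : 1 ≤ c)
    (hlev : HasLevelChordArcWith Ω ε₀ c) (hδ : 0 < δ) (hδr : δ ≤ r) {Q : Finset Space}
    (hQs : ∀ p ∈ Q, p ∈ surface Ω φ) (hQa : ∀ p ∈ Q, dist p a < r)
    (hQε : ∀ p ∈ Q, bdist Ω (proj p) ≤ ε₀)
    (hsep : (↑Q : Set Space).Pairwise fun p q => 10 * δ ≤ dist p q)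
    (hsign : ∀ p ∈ Q, ∀ q ∈ Q, |p 2 - q 2| = |(|p 2| - |q 2|)|) {u : ℝ} (hu : 0 ≤ u)
    (hQu : ∀ p ∈ Q, u ≤ height Ω p ∧ height Ω p ≤ u + δ) :
    Q.card * δ ≤ (8 * c + 2) * r := by
  classical
  rcases Q.eq_empty_or_nonempty with rfl | ⟨p₀, hp₀⟩
  · simp; nlinarith
  obtain ⟨s, hs, hsu⟩ := hφ.exists_add_eq hu (height_eq (hQs p₀ hp₀) ▸ (hQu p₀ hp₀).1)
  have hsle : ∀ p ∈ Q, s ≤ bdist Ω (proj p) := fun p hp =>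
    hφ.le_of_add_le (by rw [hsu, ← height_eq (hQs p hp)]; exact (hQu p hp).1)
  have hbd : ∀ p ∈ Q, (bdist Ω (proj p) : ℝ) - s ≤ δ ∧ |(|p 2| - φ s)| ≤ δ ∧
      (φ s : ℝ) ≤ |p 2| := fun p hp => by
    have h1 := height_eq (hQs p hp)
    have h2 := (mem_surface_iff.1 (hQs p hp)).2
    have h3 : (φ s : ℝ) ≤ φ (bdist Ω (proj p)) := by
      exact_mod_cast hφ.strictMono.monotone (hsle p hp)
    have h4 : (s : ℝ) ≤ bdist Ω (proj p) := by exact_mod_cast hsle p hp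
    have h5 := (hQu p hp).2
    rw [h2, abs_of_nonneg (by linarith)]
    exact ⟨by linarith, by linarith, h3⟩
  have hex : ∀ p, ∃ y, p ∈ Q → y ∈ levelSet Ω s ∧ dist y (proj p) ≤ δ := fun p => by
    by_cases hp : p ∈ Q
    · obtain ⟨y, hy, hyd⟩ := hΩ.exists_mem_levelSet_dist_le (mem_surface_iff.1 (hQs p hp)).1
        (hsle p hp)
      exact ⟨y, fun _ => ⟨hy, hyd.trans (hbd p hp).1⟩⟩
    · exact ⟨0, fun h => absurd h hp⟩
  choose Y hY using hex
  have hYsep : ∀ p ∈ Q, ∀ q ∈ Q, p ≠ q → δ ≤ dist (Y p) (Y q) := fun p hp q hq hpq => by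
    have h1 := hsep hp hq hpq
    have h2 := dist_le_dist_proj_add p q
    rw [hsign p hp q hq] at h2
    have h3 : |(|p 2| - |q 2|)| ≤ δ := by
      have hp' := abs_le.1 (hbd p hp).2.1
      have hq' := abs_le.1 (hbd q hq).2.1
      have hp'' := (hbd p hp).2.2
      have hq'' := (hbd q hq).2.2
      exact abs_le.2 ⟨by linarith, by linarith⟩
    have h4 := dist_triangle4 (proj p) (Y p) (Y q) (proj q)
    rw [dist_comm (proj p) (Y p)] at h4
    linarith [(hY p hp).2, (hY q hq).2]
  have hinj : Set.InjOn Y Q := fun p hp q hq hpq => by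
    by_contra hne
    have := hYsep p hp q hq hne
    rw [hpq, dist_self] at this
    linarith
  have hsε : s ≤ ε₀ := hs.trans (hQε p₀ hp₀)
  -- Points of the ball are at most `2 * r` apart, and each has moved by at most `δ ≤ r`; hence `D =
  -- 4 * r`.
  have key := (hlev s hsε).card_mul_le (by linarith) (P := Q.image Y) (δ := δ) (D := 4 * r) ?_ hδ
    (by linarith) ?_ ?_
  · rw [Finset.card_image_of_injOn hinj] at key
    linarith
  · intro y hy
    obtain ⟨p, hp, rfl⟩ := Finset.mem_image.1 hy
    exact (hY p hp).1
  · intro x hx y hy hxy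
    obtain ⟨p, hp, rfl⟩ := Finset.mem_image.1 hx
    obtain ⟨q, hq, rfl⟩ := Finset.mem_image.1 hy
    exact hYsep p hp q hq (fun h => hxy (h ▸ rfl))
  · intro x hx y hy
    obtain ⟨p, hp, rfl⟩ := Finset.mem_image.1 hx
    obtain ⟨q, hq, rfl⟩ := Finset.mem_image.1 hy
    have h4 := dist_triangle4 (Y p) (proj p) (proj q) (Y q)
    rw [dist_comm (proj q) (Y q)] at h4
    linarith [(hY p hp).2, (hY q hq).2, dist_proj_le p q, dist_triangle_right p q a, hQa p hp,
      hQa q hq]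

theorem card_mul_sq_le_of_bdist_le (hΩ : IsJordanDomain Ω) (hφ : IsGauge φ) (hc : 1 ≤ c)
    (hlev : HasLevelChordArcWith Ω ε₀ c) (hδ : 0 < δ) (hδr : δ ≤ r) {P : Finset Space}
    (hPs : ∀ p ∈ P, p ∈ surface Ω φ) (hPa : ∀ p ∈ P, dist p a < r)
    (hPε : ∀ p ∈ P, bdist Ω (proj p) ≤ ε₀)
    (hsep : (↑P : Set Space).Pairwise fun p q => 10 * δ ≤ dist p q) :
    P.card * δ ^ 2 ≤ 120 * c * r ^ 2 := by
  classical
  have hr : 0 < r := hδ.trans_le hδr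
  -- Points are sorted by slab of thickness `δ` and by sheet. The height varies by at most `2 * r`
  -- from the centre, so at most `4 * r / δ + 2` slabs occur, each counted twice.
  set κ : Space → ℤ × Bool := fun p => (⌊height Ω p / δ⌋, decide (0 ≤ p 2)) with hκ
  set m₁ := ⌊(height Ω a - 2 * r) / δ⌋ with hm₁
  set m₂ := ⌊(height Ω a + 2 * r) / δ⌋ with hm₂
  set T : Finset (ℤ × Bool) := Finset.Icc m₁ m₂ ×ˢ Finset.univ with hT
  have hmaps : ∀ p ∈ P, κ p ∈ T := fun p hp => by
    have h1 := height_le_add Ω p a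
    have h2 := height_le_add Ω a p
    have h3 := hPa p hp
    rw [dist_comm a p] at h2
    simp only [hT, hκ, Finset.mem_product, Finset.mem_univ, and_true, Finset.mem_Icc]
    constructor <;> refine Int.floor_le_floor ?_ <;> gcongr <;> linarith
  have hTcard : (T.card : ℝ) * δ ≤ 12 * r := by
    have h1 : m₁ ≤ m₂ := by
      refine Int.floor_le_floor ?_
      gcongr
      linarith
    have h2 : ((Finset.Icc m₁ m₂).card : ℝ) = m₂ + 1 - m₁ := by
      rw [Int.card_Icc]
      have : ((m₂ + 1 - m₁).toNat : ℤ) = m₂ + 1 - m₁ := Int.toNat_of_nonneg (by omega)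
      exact_mod_cast this
    have h3 : (m₂ : ℝ) * δ ≤ height Ω a + 2 * r := (le_div_iff₀ hδ).1 (Int.floor_le _)
    have h4 : height Ω a - 2 * r < (m₁ + 1) * δ := (div_lt_iff₀ hδ).1 (Int.lt_floor_add_one _)
    rw [hT, Finset.card_product, Finset.card_univ, Fintype.card_bool]
    push_cast
    rw [h2]
    linarith
  set n := ⌊(8 * c + 2) * r / δ⌋₊ with hn
  have hfib : ∀ b ∈ T, (P.filter fun p => κ p = b).card ≤ n := by
    rintro ⟨k, σ⟩ -
    refine Nat.le_floor ((le_div_iff₀ hδ).2 ?_)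
    set Q := P.filter fun p => κ p = (k, σ) with hQ
    have hQP : ∀ p ∈ Q, p ∈ P := fun p hp => (Finset.mem_filter.1 hp).1
    have hQk : ∀ p ∈ Q, ⌊height Ω p / δ⌋ = k ∧ decide (0 ≤ p 2) = σ := fun p hp => by
      simpa [hκ] using (Finset.mem_filter.1 hp).2
    rcases Q.eq_empty_or_nonempty with h0 | ⟨p₀, hp₀⟩
    · rw [h0]
      simp only [Finset.card_empty, Nat.cast_zero, zero_mul]
      positivity
    have hk0 : (0 : ℝ) ≤ k := by
      have : 0 ≤ ⌊height Ω p₀ / δ⌋ := Int.floor_nonneg.2 (div_nonneg (height_nonneg _ _) hδ.le)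
      rw [(hQk p₀ hp₀).1] at this
      exact_mod_cast this
    refine card_mul_le_of_height_le hΩ hφ hc hlev hδ hδr (a := a) (fun p hp => hPs p (hQP p hp))
      (fun p hp => hPa p (hQP p hp)) (fun p hp => hPε p (hQP p hp))
      (hsep.mono fun p hp => hQP p hp) ?_ (u := k * δ) (by positivity) ?_
    · intro p hp q hq
      have h1 : (0 ≤ p 2 ↔ 0 ≤ q 2) := by
        rw [← decide_eq_decide, (hQk p hp).2, (hQk q hq).2]
      by_cases h2 : 0 ≤ p 2
      · rw [abs_of_nonneg h2, abs_of_nonneg (h1.1 h2)]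
      · have h3 : ¬ 0 ≤ q 2 := fun h => h2 (h1.2 h)
        rw [abs_of_neg (not_le.1 h2), abs_of_neg (not_le.1 h3), ← abs_neg]
        congr 1
        ring
    · intro p hp
      have h1 := (hQk p hp).1
      have h2 := Int.floor_le (height Ω p / δ)
      have h3 := Int.lt_floor_add_one (height Ω p / δ)
      rw [h1, le_div_iff₀ hδ] at h2
      rw [h1, div_lt_iff₀ hδ] at h3
      exact ⟨h2, by linarith⟩
  have hcard : (P.card : ℝ) ≤ n * T.card := by
    exact_mod_cast Finset.card_le_mul_card_image_of_maps_to hmaps n hfib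
  have hnle : (n : ℝ) * δ ≤ (8 * c + 2) * r :=
    (le_div_iff₀ hδ).1 (Nat.floor_le (by positivity))
  calc (P.card : ℝ) * δ ^ 2 ≤ n * T.card * δ ^ 2 := by gcongr
    _ = (n * δ) * (T.card * δ) := by ring
    _ ≤ ((8 * c + 2) * r) * (12 * r) := by gcongr
    _ ≤ 120 * c * r ^ 2 := by nlinarith [sq_nonneg r]

theorem hausdorffMeasure_two_shallow_le (hΩ : IsJordanDomain Ω) (hφ : IsGauge φ) (hc : 1 ≤ c)
    (hlev : HasLevelChordArcWith Ω ε₀ c) (hr : 0 < r) :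
    Measure.hausdorffMeasure 2 (surface Ω φ ∩ Metric.ball a r ∩ {p | bdist Ω (proj p) ≤ ε₀}) ≤
      ENNReal.ofReal (48000 * c * r ^ 2) := by
  have := hausdorffMeasure_two_le_of_packing
    (A := surface Ω φ ∩ Metric.ball a r ∩ {p | bdist Ω (proj p) ≤ ε₀})
    (M := 12000 * c * r ^ 2) (δ₀ := 10 * r) (by positivity) fun δ hδ hδr P hP hsep => ?_
  · refine this.trans (le_of_eq ?_)
    congr 1
    ring
  · have h1 := card_mul_sq_le_of_bdist_le (δ := δ / 10) (a := a) hΩ hφ hc hlev (by positivity)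
      (by linarith) (fun p hp => (hP hp).1.1) (fun p hp => (hP hp).1.2) (fun p hp => (hP hp).2)
      (by rwa [mul_div_cancel₀ _ (by norm_num : (10 : ℝ) ≠ 0)])
    linarith

theorem lipschitzOnWith_lift {L : ℝ≥0} (hL : LipschitzOnWith L φ (Ici (ε₀ / 3))) {σ : ℝ}
    (hσ : |σ| = 1) :
    LipschitzOnWith (1 + L) (fun y => lift y (σ * φ (bdist Ω y))) {y | ε₀ / 3 ≤ bdist Ω y} := by
  refine LipschitzOnWith.of_dist_le_mul fun x hx y hy => ?_
  refine (dist_le_dist_proj_add _ _).trans ?_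
  have h1 := hL.dist_le_mul (bdist Ω x) hx (bdist Ω y) hy
  have h2 := (lipschitzWith_bdist Ω).dist_le_mul x y
  rw [NNReal.dist_eq] at h1
  simp only [proj_lift, lift_apply_two, NNReal.coe_add, NNReal.coe_one, one_mul] at h2 ⊢
  rw [← mul_sub, abs_mul, hσ, one_mul]
  have h3 : (L : ℝ) * dist (bdist Ω x) (bdist Ω y) ≤ L * dist x y := by gcongr
  linarith

theorem hausdorffMeasure_two_deep_le {L : ℝ≥0} (hL : LipschitzOnWith L φ (Ici (ε₀ / 3)))
    (hr : 0 < r) :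
    Measure.hausdorffMeasure 2
      (surface Ω φ ∩ Metric.ball a r ∩ {p | ε₀ / 3 ≤ bdist Ω (proj p)}) ≤
      ENNReal.ofReal (16 * (1 + L) ^ 2 * r ^ 2) := by
  set D := Metric.ball (proj a) r ∩ {y | ε₀ / 3 ≤ bdist Ω y} with hD
  have hone : ∀ σ : ℝ, |σ| = 1 → Measure.hausdorffMeasure 2
      ((fun y => lift y (σ * φ (bdist Ω y))) '' D) ≤ ENNReal.ofReal (8 * (1 + L) ^ 2 * r ^ 2) := by
    intro σ hσ
    have h1 := ((lipschitzOnWith_lift (Ω := Ω) hL hσ).mono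
      (inter_subset_right (s := Metric.ball (proj a) r))).hausdorffMeasure_image_le
      (d := 2) (by norm_num)
    refine h1.trans ((mul_le_mul_right ((measure_mono inter_subset_left).trans
      (hausdorffMeasure_two_ball_plane_le (proj a) hr)) _).trans (le_of_eq ?_))
    rw [ENNReal.rpow_two, ← ENNReal.coe_pow, ← ENNReal.ofReal_coe_nnreal,
      ← ENNReal.ofReal_mul (by positivity)]
    congr 1
    push_cast
    ring
  have hsub : surface Ω φ ∩ Metric.ball a r ∩ {p | ε₀ / 3 ≤ bdist Ω (proj p)} ⊆
      ((fun y => lift y (1 * φ (bdist Ω y))) '' D) ∪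
        ((fun y => lift y (-1 * φ (bdist Ω y))) '' D) := by
    rintro p ⟨⟨hp, hpa⟩, hpε⟩
    have hpD : proj p ∈ D := ⟨(dist_proj_le p a).trans_lt hpa, hpε⟩
    rcases hp.2 with h | h
    · exact Or.inl ⟨proj p, hpD, by simp only [one_mul, ← h, lift_proj]⟩
    · exact Or.inr ⟨proj p, hpD, by simp only [neg_mul, one_mul, ← h, lift_proj]⟩
  refine (measure_mono hsub).trans ((measure_union_le _ _).trans
    ((add_le_add (hone 1 (by simp)) (hone (-1) (by simp))).trans (le_of_eq ?_)))
  rw [← ENNReal.ofReal_add (by positivity) (by positivity)]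
  congr 1
  ring

theorem hausdorffMeasure_two_surface_inter_ball_le {L : ℝ≥0} (hΩ : IsJordanDomain Ω)
    (hφ : IsGauge φ) (hc : 1 ≤ c) (hlev : HasLevelChordArcWith Ω ε₀ c)
    (hL : LipschitzOnWith L φ (Ici (ε₀ / 3))) (a : Space) (hr : 0 < r) :
    Measure.hausdorffMeasure 2 (surface Ω φ ∩ Metric.ball a r) ≤
      ENNReal.ofReal ((48000 * c + 16 * (1 + L) ^ 2) * r ^ 2) := by
  have hsub : surface Ω φ ∩ Metric.ball a r ⊆
      (surface Ω φ ∩ Metric.ball a r ∩ {p | bdist Ω (proj p) ≤ ε₀}) ∪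
        (surface Ω φ ∩ Metric.ball a r ∩ {p | ε₀ / 3 ≤ bdist Ω (proj p)}) := by
    intro p hp
    rcases le_total (bdist Ω (proj p)) ε₀ with h | h
    · exact Or.inl ⟨hp, h⟩
    · exact Or.inr ⟨hp, (div_le_self zero_le (by norm_num)).trans h⟩
  refine (measure_mono hsub).trans ((measure_union_le _ _).trans ((add_le_add
    (hausdorffMeasure_two_shallow_le hΩ hφ hc hlev hr)
    (hausdorffMeasure_two_deep_le hL hr)).trans (le_of_eq ?_)))
  rw [← ENNReal.ofReal_add (by positivity) (by positivity)]
  congr 1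
  ring

end UpperBound

/-! ### The lower bound -/

section LowerBound

variable {Ω : Set Plane} {φ : ℝ≥0 → ℝ≥0} {c : ℝ} {ε₀ L : ℝ≥0} {a : Space}

theorem IsChordArcCurve.isJordanCurve {S : Set Plane} (h : IsChordArcCurve c S) :
    IsJordanCurve S :=
  let ⟨g, hg, _⟩ := h
  ⟨g, hg⟩

theorem HasLevelChordArcWith.exists_bdist_eq (hlev : HasLevelChordArcWith Ω ε₀ c) :
    ∃ x ∈ closure Ω, bdist Ω x = ε₀ := by
  obtain ⟨g, hg⟩ := (hlev ε₀ le_rfl).isJordanCurve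
  have : g 0 ∈ levelSet Ω ε₀ := hg.image_eq ▸ mem_image_of_mem g ⟨le_rfl, zero_le_one⟩
  exact ⟨g 0, this.1, this.2⟩

/-- Transfer of `exists_mem_sphere_le_infDist` from `ℂ`: bounded turning comes from the level 0, and
the outer point `q'` from the level `ε₀`. -/
theorem exists_dist_eq_le_bdist (hΩ : IsJordanDomain Ω) (hc : 1 ≤ c)
    (hlev : HasLevelChordArcWith Ω ε₀ c) {p : Plane} (hp : p ∈ frontier Ω) {ρ : ℝ} (hρ : 0 < ρ)
    (hρε : 2 * ρ ≤ ε₀) : ∃ w ∈ closure Ω, dist w p = ρ ∧ ρ / (100 * c) ≤ bdist Ω w := by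
  obtain ⟨q', hq', hq'ε⟩ := hlev.exists_bdist_eq
  have hε₀ : (0 : ℝ) < ε₀ := by linarith
  have hq'Ω : q' ∈ Ω := hΩ.mem_of_bdist_pos hq' (by rw [hq'ε]; exact_mod_cast hε₀)
  obtain ⟨q, hq, hqp⟩ := Metric.mem_closure_iff.1 (frontier_subset_closure hp) (ρ / 2)
    (by positivity)
  have hq'p : (ε₀ : ℝ) ≤ dist q' p := by
    rw [← hq'ε, coe_bdist]
    exact Metric.infDist_le_dist_of_mem hp
  let e : Plane ≃ₗᵢ[ℝ] ℂ := Complex.orthonormalBasisOneI.repr.symm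
  have hfr : frontier (e '' Ω) = e '' frontier Ω := (e.toHomeomorph.image_frontier Ω).symm
  have hcl : closure (e '' Ω) = e '' closure Ω := (e.toHomeomorph.image_closure Ω).symm
  have hΓ := hlev 0 zero_le
  rw [hΩ.levelSet_zero] at hΓ
  obtain ⟨w', hw', hwp, hwd⟩ := exists_mem_sphere_le_infDist (Ω := e '' Ω)
    (e.toHomeomorph.isOpenMap Ω hΩ.isOpen)
    (hΩ.isConnected.isPreconnected.image e e.continuous.continuousOn)
    (e.lipschitz.isBounded_image hΩ.isBounded) hc (p := e p) (q := e q) (q' := e q') (ρ := ρ)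
    (by
      rw [hfr]
      rintro _ ⟨u, hu, rfl⟩ _ ⟨v, hv, rfl⟩
      obtain ⟨J, hJ, hJc, huJ, hvJ, hd⟩ := hΓ.exists_isPreconnected (by linarith) hu hv
      refine ⟨e '' J, image_mono hJ, hJc.image e e.continuous.continuousOn,
        mem_image_of_mem e huJ, mem_image_of_mem e hvJ, ?_⟩
      rintro _ ⟨x, hx, rfl⟩
      rw [e.dist_map, e.dist_map]
      exact hd x hx u huJ)
    (by rw [hfr]; exact hΩ.frontier_nonempty.image e) hρ (mem_image_of_mem e hq)
    (mem_image_of_mem e hq'Ω) (by rw [e.dist_map, dist_comm]; exact hqp.le)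
    (by rw [e.dist_map]; linarith)
  rw [hcl] at hw'
  obtain ⟨w, hw, rfl⟩ := hw'
  rw [hfr, Metric.infDist_image e.isometry] at hwd
  exact ⟨w, hw, by rwa [e.dist_map] at hwp, hwd⟩

/-- Each level curve below `w` has a point within `bdist Ω w - s` of `w` and another point at least
`ε₀ - s ≥ ε₀ / 3` from that one. It therefore contains a connected piece of diameter at least `ρ`
near `w`, and the pieces lifted to one sheet are slices of the height. -/
theorem mul_le_hausdorffMeasure_two_of_levels (hΩ : IsJordanDomain Ω) (hφ : IsGauge φ)
    (hlev : HasLevelChordArcWith Ω ε₀ c) {w : Plane} (hw : w ∈ closure Ω) {σ : ℝ}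
    (hσ : |σ| = 1) {u₁ u₂ ρ : ℝ} (hρ : 0 < ρ) (hu₁ : 0 ≤ u₁)
    (hu₂ : u₂ ≤ bdist Ω w + φ (bdist Ω w)) (hwε : (bdist Ω w : ℝ) ≤ 2 / 3 * ε₀)
    (hρε : ρ ≤ ε₀ / 3) {U : Set Space}
    (hU : ∀ s ≤ bdist Ω w, u₁ ≤ s + φ s → s + φ s ≤ u₂ → ∀ y,
      dist y w ≤ bdist Ω w - s + ρ → lift y (σ * φ s) ∈ U) :
    ENNReal.ofReal ρ * ENNReal.ofReal (u₂ - u₁) ≤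
      2 * Measure.hausdorffMeasure 2 (surface Ω φ ∩ U) := by
  obtain ⟨x₀, hx₀, hx₀ε⟩ := hlev.exists_bdist_eq
  refine mul_le_hausdorffMeasure_two_of_slices (lipschitzWith_height Ω).lipschitzOnWith
    fun u hu => ?_
  obtain ⟨s, hs, hsu⟩ := hφ.exists_add_eq (hu₁.trans hu.1) (hu.2.trans hu₂)
  obtain ⟨y, hy, hyw⟩ := hΩ.exists_mem_levelSet_dist_le hw hs
  have hs' : (s : ℝ) ≤ bdist Ω w := by exact_mod_cast hs
  have hsε : (s : ℝ) < ε₀ := by linarith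
  obtain ⟨y', hy', hyy'⟩ := hΩ.exists_mem_levelSet_le_dist hx₀
    (hx₀ε.symm ▸ (by exact_mod_cast hsε : s < ε₀)) hy
  rw [hx₀ε] at hyy'
  obtain ⟨E, hES, hE, hyE, ⟨z, hzE, hyz⟩, hEρ⟩ :=
    (hlev s (by exact_mod_cast hsε.le)).isJordanCurve.exists_isPreconnected_in_closedBall hy hy'
      hρ.le (by linarith)
  have hsurf : ∀ x ∈ E, lift x (σ * φ s) ∈ surface Ω φ := fun x hx => by
    rw [mem_surface_iff, proj_lift, lift_apply_two, abs_mul, hσ, one_mul, (hES hx).2,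
      NNReal.abs_eq]
    exact ⟨(hES hx).1, rfl⟩
  refine ⟨(fun x => lift x (σ * φ s)) '' E, ?_,
    hE.image _ (continuous_lift _).continuousOn, ?_, _, mem_image_of_mem _ hyE, _,
    mem_image_of_mem _ hzE, ?_⟩
  · rintro _ ⟨x, hx, rfl⟩
    refine ⟨hsurf x hx, hU s hs (hsu ▸ hu.1) (hsu ▸ hu.2) x ?_⟩
    linarith [dist_triangle x y w, hEρ x hx]
  · rintro _ ⟨x, hx, rfl⟩
    rw [height_eq (hsurf x hx), proj_lift, (hES hx).2, hsu]
  · refine hyz.trans (le_trans ?_ (dist_proj_le _ _))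
    simp

theorem exists_sign_mul_eq {p : Space} (hp : p ∈ surface Ω φ) :
    ∃ σ : ℝ, |σ| = 1 ∧ p 2 = σ * φ (bdist Ω (proj p)) := by
  rcases hp.2 with h | h
  · exact ⟨1, by simp, by rw [h, one_mul]⟩
  · exact ⟨-1, by simp, by rw [h, neg_one_mul]⟩

/-- Over a disc of radius at most `m / 4` the boundary distance stays above `ε₀ / 3`, so the sheet
through `a` is a Lipschitz graph there and projects onto the disc. -/
theorem le_hausdorffMeasure_two_of_deep (hΩ : IsJordanDomain Ω)
    (hL : LipschitzOnWith L φ (Ici (ε₀ / 3))) (ha : a ∈ surface Ω φ) {m : ℝ} (hm : 0 < m)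
    (hmε : m ≤ ε₀) (hdeep : 2 / 3 * ε₀ ≤ (bdist Ω (proj a) : ℝ)) :
    ENNReal.ofReal ((m / (4 * (1 + L))) ^ 2) ≤
      Measure.hausdorffMeasure 2 (surface Ω φ ∩ Metric.ball a m) := by
  set ρ := m / (4 * (1 + L)) with hρdef
  have hρ : 0 < ρ := by positivity
  have hρm : ρ * (1 + L) = m / 4 := by rw [hρdef]; field_simp
  have hρ4 : ρ ≤ m / 4 := by
    rw [← hρm]
    exact le_mul_of_one_le_right hρ.le (by simp)
  obtain ⟨σ, hσ, haσ⟩ := exists_sign_mul_eq ha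
  have hsub : Metric.ball (proj a) ρ ⊆ proj '' (surface Ω φ ∩ Metric.ball a m) := by
    intro y hy
    rw [Metric.mem_ball] at hy
    have hyε : ε₀ / 3 ≤ bdist Ω y := by
      have := bdist_le_add Ω (proj a) y
      rw [dist_comm] at this
      have h3 : (ε₀ : ℝ) / 3 ≤ bdist Ω y := by linarith
      exact_mod_cast h3
    have haε : ε₀ / 3 ≤ bdist Ω (proj a) := by
      have h3 : (ε₀ : ℝ) / 3 ≤ bdist Ω (proj a) := by linarith [ε₀.coe_nonneg]
      exact_mod_cast h3
    have hyΩ : y ∈ Ω := hΩ.ball_subset ha.1 (by rw [Metric.mem_ball]; linarith)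
    refine ⟨lift y (σ * φ (bdist Ω y)), ⟨?_, ?_⟩, proj_lift _ _⟩
    · rw [mem_surface_iff, proj_lift, lift_apply_two, abs_mul, hσ, one_mul, NNReal.abs_eq]
      exact ⟨subset_closure hyΩ, rfl⟩
    · have h1 := (lipschitzOnWith_lift (Ω := Ω) hL hσ).dist_le_mul y hyε (proj a) haε
      rw [← haσ, lift_proj] at h1
      rw [Metric.mem_ball]
      refine h1.trans_lt ?_
      have : ((1 + L : ℝ≥0) : ℝ) * dist y (proj a) ≤ (1 + L) * ρ := by
        push_cast
        gcongr
      linarith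
  have h1 := (measure_mono hsub).trans (lipschitzWith_proj.hausdorffMeasure_image_le
    (d := 2) (by norm_num) _)
  simp only [ENNReal.coe_one, ENNReal.one_rpow, one_mul] at h1
  exact (le_hausdorffMeasure_two_ball_plane (proj a) hρ).trans h1

theorem le_hausdorffMeasure_two_of_shallow (hΩ : IsJordanDomain Ω) (hφ : IsGauge φ) (hc : 1 ≤ c)
    (hlev : HasLevelChordArcWith Ω ε₀ c) (ha : a ∈ surface Ω φ) {m : ℝ} (hm : 0 < m)
    (hmε : m ≤ ε₀) (hshallow : (bdist Ω (proj a) : ℝ) ≤ 2 / 3 * ε₀) :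
    ENNReal.ofReal (m / 10) * ENNReal.ofReal (m / (1000 * c)) ≤
      2 * Measure.hausdorffMeasure 2 (surface Ω φ ∩ Metric.ball a m) := by
  obtain ⟨σ, hσ, haσ⟩ := exists_sign_mul_eq ha
  have hc0 : 0 < c := by linarith
  have hmc : m / (1000 * c) ≤ m / 10 := div_le_div_of_nonneg_left hm.le (by norm_num) (by linarith)
  have hdist : ∀ y s, dist (lift y (σ * φ s)) a ≤
      dist y (proj a) + |(φ s : ℝ) - φ (bdist Ω (proj a))| := fun y s => by
    have := dist_le_dist_proj_add (lift y (σ * φ s)) a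
    rwa [proj_lift, lift_apply_two, haσ, ← mul_sub, abs_mul, hσ, one_mul] at this
  set t := bdist Ω (proj a) with ht
  -- If the height of `a` is at least `m / 10`, the levels just below `a` are used. Otherwise `a` is
  -- close to the boundary curve, and levels below a nearby point `w` of boundary distance at least
  -- `m / (1000 * c)` are used instead.
  rcases le_or_gt (m / 10) (t + φ t) with hT | hT
  · have h1 := mul_le_hausdorffMeasure_two_of_levels hΩ hφ hlev ha.1 hσ (u₁ := t + φ t - m / 10)
      (u₂ := t + φ t) (ρ := m / 10) (by positivity) (by linarith) le_rfl hshallow (by linarith)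
      (U := Metric.ball a m) (fun s hs hsu₁ _ y hy => by
        have h2 : (φ s : ℝ) ≤ φ t := by exact_mod_cast hφ.strictMono.monotone hs
        have h3 : (s : ℝ) ≤ t := by exact_mod_cast hs
        rw [Metric.mem_ball]
        refine (hdist y s).trans_lt ?_
        rw [abs_of_nonpos (by linarith)]
        linarith)
    refine le_trans ?_ h1
    gcongr
    linarith
  · obtain ⟨p, hp, hpd⟩ := hΩ.exists_dist_eq_bdist (proj a)
    obtain ⟨w, hw, hwp, hwd⟩ := exists_dist_eq_le_bdist hΩ hc hlev hp (ρ := m / 10)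
      (by positivity) (by linarith)
    have hwm : (bdist Ω w : ℝ) ≤ m / 10 := hwp ▸ Metric.infDist_le_dist_of_mem hp
    have hwd' : m / (1000 * c) ≤ bdist Ω w := by
      refine le_trans (le_of_eq ?_) hwd
      rw [div_div]
      congr 1
      ring
    have h1 := mul_le_hausdorffMeasure_two_of_levels hΩ hφ hlev hw hσ (u₁ := 0)
      (u₂ := m / (1000 * c)) (ρ := m / 10) (by positivity) le_rfl
      (hwd'.trans (le_add_of_nonneg_right (NNReal.coe_nonneg _))) (by linarith) (by linarith)
      (U := Metric.ball a m) (fun s hs _ hsu₂ y hy => by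
        have h3 := s.coe_nonneg
        have h4 := (φ s).coe_nonneg
        have h5 := t.coe_nonneg
        have h6 := (φ t).coe_nonneg
        rw [Metric.mem_ball]
        refine (hdist y s).trans_lt ?_
        have h7 : |(φ s : ℝ) - φ t| ≤ m / 10 := abs_le.2 ⟨by linarith, by linarith⟩
        have h8 := dist_triangle4 y w p (proj a)
        rw [dist_comm p] at h8
        linarith)
    rwa [sub_zero] at h1

theorem le_hausdorffMeasure_two_surface_inter_ball (hΩ : IsJordanDomain Ω) (hφ : IsGauge φ)
    (hc : 1 ≤ c) (hlev : HasLevelChordArcWith Ω ε₀ c) (hL : LipschitzOnWith L φ (Ici (ε₀ / 3)))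
    (ha : a ∈ surface Ω φ) {m : ℝ} (hm : 0 < m) (hmε : m ≤ ε₀) :
    ENNReal.ofReal (m ^ 2 / (20000 * c * (1 + L) ^ 2)) ≤
      Measure.hausdorffMeasure 2 (surface Ω φ ∩ Metric.ball a m) := by
  have hc0 : 0 < c := by linarith
  have hL1 : (1 : ℝ) ≤ (1 + L) ^ 2 := by nlinarith [L.coe_nonneg]
  rcases le_total (2 / 3 * (ε₀ : ℝ)) (bdist Ω (proj a)) with h | h
  · refine le_trans (ENNReal.ofReal_le_ofReal ?_)
      (le_hausdorffMeasure_two_of_deep hΩ hL ha hm hmε h)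
    rw [div_pow, mul_pow]
    gcongr
    nlinarith
  · have h1 := le_hausdorffMeasure_two_of_shallow hΩ hφ hc hlev ha hm hmε h
    rw [← ENNReal.ofReal_mul (by positivity), mul_comm (2 : ℝ≥0∞),
      ← ENNReal.div_le_iff (by norm_num) (by norm_num)] at h1
    refine le_trans ?_ h1
    rw [← ENNReal.ofReal_ofNat 2, ← ENNReal.ofReal_div_of_pos (by norm_num)]
    refine ENNReal.ofReal_le_ofReal ?_
    have h2 : m / 10 * (m / (1000 * c)) / 2 = m ^ 2 / (20000 * c * 1) := by
      field_simp
      norm_num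
    rw [h2]
    gcongr

end LowerBound

/-! ### Regularity of the surface -/

theorem hausdorffMeasure_ball_subtype {S : Set Space} (a : S) (r : ℝ) :
    Measure.hausdorffMeasure 2 (Metric.ball a r) =
      Measure.hausdorffMeasure 2 (S ∩ Metric.ball (a : Space) r) := by
  rw [← isometry_subtype_coe.hausdorffMeasure_image (Or.inl zero_le_two)]
  congr 1
  ext p
  constructor
  · rintro ⟨x, hx, rfl⟩
    exact ⟨x.2, hx⟩
  · rintro ⟨hp, hpa⟩
    exact ⟨⟨p, hp⟩, hpa, rfl⟩

/-- The regularity constant for radii up to `D`. -/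
noncomputable def regularityConstant (c : ℝ) (ε₀ L : ℝ≥0) (D : ℝ) : ℝ :=
  48000 * c + 16 * (1 + L) ^ 2 + 20000 * c * (1 + L) ^ 2 * ((D + ε₀) / ε₀) ^ 2

section

variable {Ω : Set Plane} {φ : ℝ≥0 → ℝ≥0} {c D : ℝ} {ε₀ L : ℝ≥0}

theorem one_lt_regularityConstant (hc : 1 ≤ c) : 1 < regularityConstant c ε₀ L D := by
  unfold regularityConstant
  have h1 : 0 ≤ 16 * (1 + (L : ℝ)) ^ 2 := by positivity
  have h2 : 0 ≤ 20000 * c * (1 + (L : ℝ)) ^ 2 * ((D + ε₀) / ε₀) ^ 2 := by positivity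
  linarith

theorem surface_ball_bounds (hΩ : IsJordanDomain Ω) (hφ : IsGauge φ) (hc : 1 ≤ c) (hε₀ : 0 < ε₀)
    (hlev : HasLevelChordArcWith Ω ε₀ c) (hL : LipschitzOnWith L φ (Ici (ε₀ / 3)))
    (hD : 0 ≤ D) (a : surface Ω φ) {r : ℝ} (hr : 0 < r) :
    Measure.hausdorffMeasure 2 (Metric.ball a r)
        ≤ ENNReal.ofReal (regularityConstant c ε₀ L D * r ^ (2 : ℝ)) ∧
      (r ≤ D → ENNReal.ofReal ((regularityConstant c ε₀ L D)⁻¹ * r ^ (2 : ℝ))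
        ≤ Measure.hausdorffMeasure 2 (Metric.ball a r)) := by
  have hε : (0 : ℝ) < ε₀ := by exact_mod_cast hε₀
  have hc0 : 0 < c := by linarith
  rw [hausdorffMeasure_ball_subtype, Real.rpow_two]
  constructor
  · refine (hausdorffMeasure_two_surface_inter_ball_le hΩ hφ hc hlev hL a hr).trans
      (ENNReal.ofReal_le_ofReal ?_)
    gcongr
    exact le_add_of_nonneg_right (by positivity)
  · intro hrD
    -- The lower bound is available only up to radius `ε₀`; this shrinks every `r ≤ D` below both
    -- `r` and `ε₀` at the cost of a fixed factor.
    set m := r * (ε₀ / (D + ε₀)) with hm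
    have hmr : m ≤ r := mul_le_of_le_one_right hr.le
      ((div_le_one (by positivity)).2 (by linarith))
    have hmε : m ≤ ε₀ := by
      rw [hm, mul_div_left_comm]
      exact mul_le_of_le_one_right hε.le ((div_le_one (by positivity)).2 (by linarith))
    refine le_trans (ENNReal.ofReal_le_ofReal ?_)
      ((le_hausdorffMeasure_two_surface_inter_ball hΩ hφ hc hlev hL a.2 (m := m) (by positivity)
        hmε).trans (measure_mono (inter_subset_inter_right _ (Metric.ball_subset_ball hmr))))
    have h1 : m ^ 2 / (20000 * c * (1 + L) ^ 2) =
        (20000 * c * (1 + L) ^ 2 * ((D + ε₀) / ε₀) ^ 2)⁻¹ * r ^ 2 := by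
      rw [hm]
      field_simp
    rw [h1]
    gcongr
    exact le_add_of_nonneg_left (by positivity)

theorem IsGauge.le_add_mul (hφ : IsGauge φ) (hL : LipschitzOnWith L φ (Ici (ε₀ / 3))) (t : ℝ≥0) :
    (φ t : ℝ) ≤ φ (ε₀ / 3) + L * t := by
  rcases le_total t (ε₀ / 3) with h | h
  · have h1 : (φ t : ℝ) ≤ φ (ε₀ / 3) := by exact_mod_cast hφ.strictMono.monotone h
    exact h1.trans (le_add_of_nonneg_right (by positivity))
  · have h1 := hL.dist_le_mul t h (ε₀ / 3) self_mem_Ici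
    have h2 : ((ε₀ / 3 : ℝ≥0) : ℝ) ≤ t := by exact_mod_cast h
    rw [NNReal.dist_eq, NNReal.dist_eq, abs_of_nonneg (by linarith : (0 : ℝ) ≤ t - _)] at h1
    have h3 := le_abs_self ((φ t : ℝ) - φ (ε₀ / 3))
    have h4 : (L : ℝ) * (t - (ε₀ / 3 : ℝ≥0)) ≤ L * t := by
      gcongr
      exact sub_le_self _ (NNReal.coe_nonneg _)
    linarith

/-- Bounds the radii to be considered in terms of the data alone: `φ` is at most `H + L * diam Ω`
over `Ω`. -/
theorem ediam_surface_le (hΩ : IsJordanDomain Ω) (hφ : IsGauge φ)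
    (hL : LipschitzOnWith L φ (Ici (ε₀ / 3))) {H : ℝ≥0} (hH : φ (ε₀ / 3) ≤ H) :
    Metric.ediam (univ : Set (surface Ω φ)) ≤
      ENNReal.ofReal (Metric.diam Ω + 2 * (H + L * Metric.diam Ω)) := by
  have hdist : ∀ x ∈ closure Ω, ∀ y ∈ closure Ω, dist x y ≤ Metric.diam Ω := fun x hx y hy => by
    rw [← Metric.diam_closure]
    exact Metric.dist_le_diam_of_mem hΩ.isBounded.closure hx hy
  have hz : ∀ p ∈ surface Ω φ, |p 2| ≤ H + L * Metric.diam Ω := fun p hp => by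
    rw [(mem_surface_iff.1 hp).2]
    obtain ⟨q, hq, hqd⟩ := hΩ.exists_dist_eq_bdist (proj p)
    have h1 := hφ.le_add_mul hL (bdist Ω (proj p))
    have h2 : (bdist Ω (proj p) : ℝ) ≤ Metric.diam Ω :=
      hqd ▸ hdist _ hp.1 _ (frontier_subset_closure hq)
    have h3 : (φ (ε₀ / 3) : ℝ) ≤ H := by exact_mod_cast hH
    have h4 : (L : ℝ) * bdist Ω (proj p) ≤ L * Metric.diam Ω := by gcongr
    linarith
  refine Metric.ediam_le_of_forall_dist_le fun p _ q _ => ?_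
  have h1 := dist_le_dist_proj_add (p : Space) q
  have h2 := abs_sub (p.1 2) (q.1 2)
  have h3 := hdist _ p.2.1 _ q.2.1
  have h4 := hz p p.2
  have h5 := hz q q.2
  rw [Subtype.dist_eq]
  linarith

theorem isAhlforsRegularWith_surface (hΩ : IsJordanDomain Ω) (hφ : IsGauge φ) (hc : 1 ≤ c)
    (hε₀ : 0 < ε₀) (hlev : HasLevelChordArcWith Ω ε₀ c)
    (hL : LipschitzOnWith L φ (Ici (ε₀ / 3))) {H : ℝ≥0} (hH : φ (ε₀ / 3) ≤ H) :
    IsAhlforsRegularWith (surface Ω φ) 2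
      (regularityConstant c ε₀ L (Metric.diam Ω + 2 * (H + L * Metric.diam Ω))) := by
  have hd : 0 ≤ Metric.diam Ω := Metric.diam_nonneg
  intro a r hr hrd
  have hD : 0 ≤ Metric.diam Ω + 2 * (H + L * Metric.diam Ω) := by positivity
  have hbounds := surface_ball_bounds hΩ hφ hc hε₀ hlev hL hD a hr
  exact ⟨hbounds.2 ((ENNReal.ofReal_le_ofReal_iff hD).1
    (hrd.trans (ediam_surface_le hΩ hφ hL hH))), hbounds.1⟩

end

end DoubleDome

theorem mainTheorem8 :
    (∀ (Ω : Set DoubleDome.Plane) (φ : ℝ≥0 → ℝ≥0), DoubleDome.IsJordanDomain Ω →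
      DoubleDome.HasLevelChordArc Ω → DoubleDome.IsGauge φ →
      DoubleDome.IsAhlforsRegular (DoubleDome.surface Ω φ) 2) ∧
    (∀ (c₀ : ℝ) (ε₀ L : ℝ≥0) (d : ℝ), 1 ≤ c₀ → 0 < ε₀ →
      (∃ C : ℝ, 1 < C ∧ ∀ (Ω : Set DoubleDome.Plane) (φ : ℝ≥0 → ℝ≥0),
        DoubleDome.IsJordanDomain Ω → DoubleDome.HasLevelChordArcWith Ω ε₀ c₀ →
        Metric.diam Ω = d → DoubleDome.IsGauge φ → LipschitzOnWith L φ (Set.Ici (ε₀ / 3)) →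
        ∀ (a : DoubleDome.surface Ω φ) (r : ℝ), 0 < r →
          MeasureTheory.Measure.hausdorffMeasure 2 (Metric.ball a r)
              ≤ ENNReal.ofReal (C * r ^ (2 : ℝ)) ∧
          (r ≤ d → ENNReal.ofReal (C⁻¹ * r ^ (2 : ℝ))
              ≤ MeasureTheory.Measure.hausdorffMeasure 2 (Metric.ball a r))) ∧
      (∀ H : ℝ≥0, ∃ C : ℝ, 1 < C ∧ ∀ (Ω : Set DoubleDome.Plane) (φ : ℝ≥0 → ℝ≥0),
        DoubleDome.IsJordanDomain Ω → DoubleDome.HasLevelChordArcWith Ω ε₀ c₀ →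
        Metric.diam Ω = d → DoubleDome.IsGauge φ → LipschitzOnWith L φ (Set.Ici (ε₀ / 3)) →
        φ (ε₀ / 3) ≤ H →
        DoubleDome.IsAhlforsRegularWith (DoubleDome.surface Ω φ) 2 C)) := by
  refine ⟨?_, fun c₀ ε₀ L d hc hε₀ => ⟨?_, fun H => ?_⟩⟩
  · rintro Ω φ hΩ ⟨ε₀, hε₀, c, hc, hlev⟩ hφ
    obtain ⟨L, hL⟩ := hφ.lipschitz (ε₀ / 3) (by positivity)
    exact ⟨_, DoubleDome.one_lt_regularityConstant hc,
      DoubleDome.isAhlforsRegularWith_surface hΩ hφ hc hε₀ hlev hL le_rfl⟩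
  · refine ⟨DoubleDome.regularityConstant c₀ ε₀ L d, DoubleDome.one_lt_regularityConstant hc, ?_⟩
    rintro Ω φ hΩ hlev rfl hφ hL a r hr
    exact DoubleDome.surface_ball_bounds hΩ hφ hc hε₀ hlev hL Metric.diam_nonneg a hr
  · refine ⟨DoubleDome.regularityConstant c₀ ε₀ L (d + 2 * (H + L * d)),
      DoubleDome.one_lt_regularityConstant hc, ?_⟩
    rintro Ω φ hΩ hlev rfl hφ hL hH
    exact DoubleDome.isAhlforsRegularWith_surface hΩ hφ hc hε₀ hlev hL hH
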